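/- Let $r,n\ge 1$, let $q$ be an indeterminate, $\zeta=e^{2\pi i/r}$, let $A=(\zeta^{j(i-1)})_{1\le i,j\le r}$, $\Delta=\det A$, and let $B=(b_{ij})$ be the adjugate of $A$, so that $A^{-1}=\Delta^{-1}B$. For $1\le c\le r$ put $F_c(X)=\sum_{j=1}^{r} b_{cj}X^{j-1}$. Let $R=\mathbb Z[\tfrac1r][q,q^{-1},\zeta,\Delta^{-1}]$. Indices of the generators $t_j,w_j$ and of $T_{s_i},h_{s_i}$ below are read modulo $n$ (in particular $t_0=t_n$, $w_0=w_n$). All sums $\sum_{c_1<c_2}$ run over $1\le c_1<c_2\le r$. Let $\widehat H^{\mathrm{aff}}_{r,n}$ be the associative $R$-algebra with generators $t_1,\dots,t_n$, $T_{s_0},\dots,T_{s_{n-1}}$, $T_\rho^{\pm1}$ and relations: $t_i^r=1$; $t_it_j=t_jt_i$; $T_{s_i}t_j=t_{s_i(j)}T_{s_i}$ for $1\le i\le n-1$, $1\le j\le n$, where $s_i=(i,i+1)$; $T_\rho t_j=t_{j-1}T_\rho$; $T_\rho T_{s_i}=T_{s_{i-1}}T_\rho$; $T_{s_i}T_{s_j}=T_{s_j}T_{s_i}$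 if $i-j\not\equiv\pm1 \pmod n$; $T_{s_i}T_{s_{i+1}}T_{s_i}=T_{s_{i+1}}T_{s_i}T_{s_{i+1}}$ for all $i$ if $n\ge3$; $T_{s_i}^2=1+(q-q^{-1})e_iT_{s_i}$ for $0\le i\le n-1$, where $e_i=\frac1r\sum_{s=0}^{r-1}t_i^st_{i+1}^{-s}$; $T_\rho T_\rho^{-1}=T_\rho^{-1}T_\rho=1$. Let $\widehat{\mathcal C}^{\mathrm{aff}}_{r,n}$ be the associative $R$-algebra with generators $w_1,\dots,w_n$, $h_{s_0},\dots,h_{s_{n-1}}$, $h_\rho^{\pm1}$ and relations: $w_i^r=1$; $w_iw_j=w_jw_i$; $h_\rho w_j=w_{j-1}h_\rho$; $h_\rho h_{s_i}=h_{s_{i-1}}h_\rho$; $h_{s_i}h_{s_j}=h_{s_j}h_{s_i}$ if $i-j\not\equiv\pm1\pmod n$; $h_{s_i}h_{s_{i+1}}h_{s_i}=h_{s_{i+1}}h_{s_i}h_{s_{i+1}}$ for all $i$ if $n\ge3$; $h_{s_i}^2=1+(q-q^{-1})h_{s_i}$ for $0\le i\le n-1$; and, for $1\le i\le n-1$, $$h_{s_i}w_i=w_{i+1}h_{s_i}-\Delta^{-2}\sum_{c_1<c_2}(\zeta^{c_2}-\zeta^{c_1})(q-q^{-1})F_{c_1}(w_i)F_{c_2}(w_{i+1}),$$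 $$h_{s_i}w_{i+1}=w_ih_{s_i}+\Delta^{-2}\sum_{c_1<c_2}(\zeta^{c_2}-\zeta^{c_1})(q-q^{-1})F_{c_1}(w_i)F_{c_2}(w_{i+1}),$$ $h_{s_i}w_l=w_lh_{s_i}$ for $l\ne i,i+1$; and $h_\rho h_\rho^{-1}=h_\rho^{-1}h_\rho=1$. (1) There is an isomorphism of $R$-algebras $\phi:\widehat H^{\mathrm{aff}}_{r,n}\to\widehat{\mathcal C}^{\mathrm{aff}}_{r,n}$ with $\phi(t_j)=w_j$ for $1\le j\le n$, $$\phi(T_{s_i})=h_{s_i}-\Delta^{-2}(q-q^{-1})\sum_{c_1<c_2}F_{c_1}(w_i)F_{c_2}(w_{i+1})\qquad(0\le i\le n-1),$$ and $\phi(T_\rho^{\pm1})=h_\rho^{\pm1}$. Its inverse $\psi$ satisfies $\psi(w_j)=t_j$, $$\psi(h_{s_i})=T_{s_i}+\Delta^{-2}(q-q^{-1})\sum_{c_1<c_2}F_{c_1}(t_i)F_{c_2}(t_{i+1})\qquad(0\le i\le n-1),$$ and $\psi(h_\rho^{\pm1})=T_\rho^{\pm1}$. (2) Let $\widehat Y_{r,n}$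 be the affine Yokonuma--Hecke algebra over $R$, with generators $\bar t_1,\dots,\bar t_n$, $g_1,\dots,g_{n-1}$, $X_1^{\pm1}$ and relations: $g_ig_j=g_jg_i$ if $|i-j|\ge2$; $g_ig_{i+1}g_i=g_{i+1}g_ig_{i+1}$ for $1\le i\le n-2$; $\bar t_i\bar t_j=\bar t_j\bar t_i$; $g_i\bar t_j=\bar t_{s_i(j)}g_i$; $\bar t_i^r=1$; $g_i^2=1+(q-q^{-1})\bar e_ig_i$ with $\bar e_i=\frac1r\sum_{s=0}^{r-1}\bar t_i^s\bar t_{i+1}^{-s}$; $X_1X_1^{-1}=X_1^{-1}X_1=1$; $g_1X_1g_1X_1=X_1g_1X_1g_1$; $g_iX_1=X_1g_i$ for $2\le i\le n-1$; $\bar t_jX_1=X_1\bar t_j$. If $n\ge2$, then $\widehat{\mathcal C}^{\mathrm{aff}}_{r,n}$ is a presentation of $\widehat Y_{r,n}$: there is an isomorphism of $R$-algebras $\theta:\widehat Y_{r,n}\to\widehat{\mathcal C}^{\mathrm{aff}}_{r,n}$ with $\theta(\bar t_j)=w_j$ for $1\le j\le n$, $\theta(g_i)=h_{s_i}-\Delta^{-2}(q-q^{-1})\sum_{c_1<c_2}F_{c_1}(w_i)F_{c_2}(w_{i+1})$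 for $1\le i\le n-1$, and $\theta(g_{n-1}\cdots g_1X_1)=h_\rho$. -/

import Mathlib

namespace AffineYokonumaHecke

noncomputable section

/-! ### Vandermonde data

Rows, columns and the index `c` of `F_c` run over `Fin r`; the element `k` of `Fin r` stands for the
index `k + 1` of `1, …, r`. -/

/-- The `r × r` matrix with entries `z ^ (j (i - 1))` for `1 ≤ i, j ≤ r`. -/
def vdm {k : Type*} [CommRing k] (r : ℕ) (z : k) : Matrix (Fin r) (Fin r) k :=
  Matrix.of fun i j => z ^ (((j : ℕ) + 1) * (i : ℕ))

/-- The polynomial `F_c(X) = ∑_{1 ≤ j ≤ r} b_{cj} X^{j-1}`, where `(b_{ij})` is the adjugate of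
`vdm r z`. -/
def vdmPoly {k : Type*} [CommRing k] (r : ℕ) (z : k) (c : Fin r) : Polynomial k :=
  ∑ j : Fin r, Polynomial.C ((vdm r z).adjugate c j) * Polynomial.X ^ (j : ℕ)

/-! ### The ring of coefficients -/

/-- The complex number `exp (2 π i / r)`. -/
def zetaC (r : ℕ) : ℂ := Complex.exp (2 * Real.pi * Complex.I / r)

/-- The subring `ℤ[1/r, ζ, Δ⁻¹]` of `ℂ`, where `Δ` is the Vandermonde determinant. -/
def baseRing (r : ℕ) : Subalgebra ℤ ℂ :=
  Algebra.adjoin ℤ {(r : ℂ)⁻¹, zetaC r, ((vdm r (zetaC r)).det)⁻¹}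

/-- The ring `R = ℤ[1/r][q, q⁻¹, ζ, Δ⁻¹]`, with `q` an indeterminate. -/
abbrev Coeff (r : ℕ) : Type := LaurentPolynomial (baseRing r)

/-- The element `q - q⁻¹` of `R`. -/
def qdiff (r : ℕ) : Coeff r := LaurentPolynomial.T 1 - LaurentPolynomial.T (-1)

/-- The element `1/r` of `R`. -/
def rInv (r : ℕ) : Coeff r :=
  LaurentPolynomial.C ⟨(r : ℂ)⁻¹, Algebra.subset_adjoin (by simp)⟩

/-- The element `ζ` of `R`. -/
def zeta (r : ℕ) : Coeff r :=
  LaurentPolynomial.C ⟨zetaC r, Algebra.subset_adjoin (by simp)⟩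

/-- The element `Δ⁻¹` of `R`. -/
def deltaInv (r : ℕ) : Coeff r :=
  LaurentPolynomial.C ⟨((vdm r (zetaC r)).det)⁻¹, Algebra.subset_adjoin (by simp)⟩

/-- The polynomial `F_c(X)` for `z = ζ`, with coefficients in `R`. -/
def F (r : ℕ) (c : Fin r) : Polynomial (Coeff r) := vdmPoly r (zeta r) c

section

variable {S : Type*} [Semiring S]

/-- The element `Δ⁻² (q - q⁻¹) ∑_{c₁ < c₂} F_{c₁}(a) F_{c₂}(b)` of an `R`-algebra. -/
def corr (r : ℕ) [Algebra (Coeff r) S] (a b : S) : S :=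
  (deltaInv r ^ 2 * qdiff r) •
    ∑ c₁ : Fin r, ∑ c₂ : Fin r with c₁ < c₂,
      Polynomial.aeval a (F r c₁) * Polynomial.aeval b (F r c₂)

/-- The element `Δ⁻² ∑_{c₁ < c₂} (ζ^{c₂} - ζ^{c₁}) (q - q⁻¹) F_{c₁}(a) F_{c₂}(b)` of an
`R`-algebra. -/
def corrZeta (r : ℕ) [Algebra (Coeff r) S] (a b : S) : S :=
  (deltaInv r ^ 2) •
    ∑ c₁ : Fin r, ∑ c₂ : Fin r with c₁ < c₂,
      ((zeta r ^ ((c₂ : ℕ) + 1) - zeta r ^ ((c₁ : ℕ) + 1)) * qdiff r) •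
        (Polynomial.aeval a (F r c₁) * Polynomial.aeval b (F r c₂))

/-- The element `(1/r) ∑_{0 ≤ s < r} a^s b^{-s}` for elements with `b ^ r = 1`, so that `b^{-s}` is
`b^{r-s}`. -/
def idem (r : ℕ) [Algebra (Coeff r) S] (a b : S) : S :=
  rInv r • ∑ s ∈ Finset.range r, a ^ s * b ^ (r - s)

end

/-! ### The algebras

They are given by generators and relations directly over `R`; extending the scalars of a presented
algebra leaves the generators and the relations as they are. The indices `1, …, n` (and
`0, …, n - 1`), with the convention that the index `0` means `n`, are taken in `ZMod n`; thus
`1 ≤ i ≤ n - 1` becomes `i ≠ 0`, and `s_i` is the transposition of `i` and `i + 1`. -/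

/-- The generators of the algebras `Ĥ` and `Ĉ`: `t_j` (resp. `w_j`), `T_{s_i}` (resp. `h_{s_i}`) and
`T_ρ^{±1}` (resp. `h_ρ^{±1}`). -/
inductive Gen (n : ℕ) : Type
  | t (j : ZMod n)
  | s (i : ZMod n)
  | rho
  | rhoInv

/-- The generator `x` of the free `R`-algebra on `Gen n`. -/
abbrev gen (r : ℕ) {n : ℕ} (x : Gen n) : FreeAlgebra (Coeff r) (Gen n) :=
  FreeAlgebra.ι (Coeff r) x

open Gen in
/-- The defining relations of `Ĥ`. -/
inductive HRel (r n : ℕ) :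
    FreeAlgebra (Coeff r) (Gen n) → FreeAlgebra (Coeff r) (Gen n) → Prop
  | t_pow (i : ZMod n) : HRel r n (gen r (t i) ^ r) 1
  | t_comm (i j : ZMod n) : HRel r n (gen r (t i) * gen r (t j)) (gen r (t j) * gen r (t i))
  | s_t (i j : ZMod n) (hi : i ≠ 0) :
      HRel r n (gen r (s i) * gen r (t j)) (gen r (t (Equiv.swap i (i + 1) j)) * gen r (s i))
  | rho_t (j : ZMod n) :
      HRel r n (gen r rho * gen r (t j)) (gen r (t (j - 1)) * gen r rho)
  | rho_s (i : ZMod n) :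
      HRel r n (gen r rho * gen r (s i)) (gen r (s (i - 1)) * gen r rho)
  | s_comm (i j : ZMod n) (h : i - j ≠ 1) (h' : i - j ≠ -1) :
      HRel r n (gen r (s i) * gen r (s j)) (gen r (s j) * gen r (s i))
  | s_braid (i : ZMod n) (hn : 3 ≤ n) :
      HRel r n (gen r (s i) * gen r (s (i + 1)) * gen r (s i))
        (gen r (s (i + 1)) * gen r (s i) * gen r (s (i + 1)))
  | s_sq (i : ZMod n) :
      HRel r n (gen r (s i) ^ 2)
        (1 + qdiff r • (idem r (gen r (t i)) (gen r (t (i + 1))) * gen r (s i)))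
  | rho_rhoInv : HRel r n (gen r rho * gen r rhoInv) 1
  | rhoInv_rho : HRel r n (gen r rhoInv * gen r rho) 1

open Gen in
/-- The defining relations of `Ĉ`. -/
inductive CRel (r n : ℕ) :
    FreeAlgebra (Coeff r) (Gen n) → FreeAlgebra (Coeff r) (Gen n) → Prop
  | w_pow (i : ZMod n) : CRel r n (gen r (t i) ^ r) 1
  | w_comm (i j : ZMod n) : CRel r n (gen r (t i) * gen r (t j)) (gen r (t j) * gen r (t i))
  | rho_w (j : ZMod n) :
      CRel r n (gen r rho * gen r (t j)) (gen r (t (j - 1)) * gen r rho)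
  | rho_h (i : ZMod n) :
      CRel r n (gen r rho * gen r (s i)) (gen r (s (i - 1)) * gen r rho)
  | h_comm (i j : ZMod n) (h : i - j ≠ 1) (h' : i - j ≠ -1) :
      CRel r n (gen r (s i) * gen r (s j)) (gen r (s j) * gen r (s i))
  | h_braid (i : ZMod n) (hn : 3 ≤ n) :
      CRel r n (gen r (s i) * gen r (s (i + 1)) * gen r (s i))
        (gen r (s (i + 1)) * gen r (s i) * gen r (s (i + 1)))
  | h_sq (i : ZMod n) : CRel r n (gen r (s i) ^ 2) (1 + qdiff r • gen r (s i))
  | h_w (i : ZMod n) (hi : i ≠ 0) :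
      CRel r n (gen r (s i) * gen r (t i))
        (gen r (t (i + 1)) * gen r (s i) - corrZeta r (gen r (t i)) (gen r (t (i + 1))))
  | h_w_succ (i : ZMod n) (hi : i ≠ 0) :
      CRel r n (gen r (s i) * gen r (t (i + 1)))
        (gen r (t i) * gen r (s i) + corrZeta r (gen r (t i)) (gen r (t (i + 1))))
  | h_w_other (i l : ZMod n) (hi : i ≠ 0) (h : l ≠ i) (h' : l ≠ i + 1) :
      CRel r n (gen r (s i) * gen r (t l)) (gen r (t l) * gen r (s i))
  | rho_rhoInv : CRel r n (gen r rho * gen r rhoInv) 1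
  | rhoInv_rho : CRel r n (gen r rhoInv * gen r rho) 1

/-- The algebra `Ĥ` (Iwahori–Matsumoto presentation) over `R`. -/
abbrev Haff (r n : ℕ) : Type := RingQuot (HRel r n)

/-- The algebra `Ĉ` over `R`. -/
abbrev Caff (r n : ℕ) : Type := RingQuot (CRel r n)

instance (r n : ℕ) : Ring (Haff r n) := Algebra.semiringToRing (Coeff r)

instance (r n : ℕ) : Ring (Caff r n) := Algebra.semiringToRing (Coeff r)

/-- The generators of `Ĥ`. -/
def hGen (r : ℕ) {n : ℕ} (x : Gen n) : Haff r n :=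
  RingQuot.mkAlgHom (Coeff r) (HRel r n) (gen r x)

/-- The generators of `Ĉ`. -/
def cGen (r : ℕ) {n : ℕ} (x : Gen n) : Caff r n :=
  RingQuot.mkAlgHom (Coeff r) (CRel r n) (gen r x)

/-! ### The affine Yokonuma–Hecke algebra -/

/-- The generators of the affine Yokonuma–Hecke algebra: `t̄_j` for `1 ≤ j ≤ n`, `g_i` for
`1 ≤ i ≤ n - 1`, and `X_1^{±1}`. -/
inductive YGen (n : ℕ) : Type
  | t (j : ZMod n)
  | g (i : {i : ℕ // 1 ≤ i ∧ i < n})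
  | X
  | XInv

/-- The generator `x` of the free `R`-algebra on `YGen n`. -/
abbrev ygen (r : ℕ) {n : ℕ} (x : YGen n) : FreeAlgebra (Coeff r) (YGen n) :=
  FreeAlgebra.ι (Coeff r) x

open YGen in
/-- The defining relations of the affine Yokonuma–Hecke algebra. -/
inductive YRel (r n : ℕ) :
    FreeAlgebra (Coeff r) (YGen n) → FreeAlgebra (Coeff r) (YGen n) → Prop
  | g_comm (i j : {i : ℕ // 1 ≤ i ∧ i < n}) (h : i.1 + 2 ≤ j.1 ∨ j.1 + 2 ≤ i.1) :
      YRel r n (ygen r (g i) * ygen r (g j)) (ygen r (g j) * ygen r (g i))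
  | g_braid (i j : {i : ℕ // 1 ≤ i ∧ i < n}) (h : j.1 = i.1 + 1) :
      YRel r n (ygen r (g i) * ygen r (g j) * ygen r (g i))
        (ygen r (g j) * ygen r (g i) * ygen r (g j))
  | t_comm (i j : ZMod n) :
      YRel r n (ygen r (t i) * ygen r (t j)) (ygen r (t j) * ygen r (t i))
  | g_t (i : {i : ℕ // 1 ≤ i ∧ i < n}) (j : ZMod n) :
      YRel r n (ygen r (g i) * ygen r (t j))
        (ygen r (t (Equiv.swap (i.1 : ZMod n) ((i.1 : ZMod n) + 1) j)) * ygen r (g i))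
  | t_pow (i : ZMod n) : YRel r n (ygen r (t i) ^ r) 1
  | g_sq (i : {i : ℕ // 1 ≤ i ∧ i < n}) :
      YRel r n (ygen r (g i) ^ 2)
        (1 + qdiff r • (idem r (ygen r (t (i.1 : ZMod n))) (ygen r (t ((i.1 : ZMod n) + 1))) * ygen r (g i)))
  | X_XInv : YRel r n (ygen r X * ygen r XInv) 1
  | XInv_X : YRel r n (ygen r XInv * ygen r X) 1
  | g_X_one (i : {i : ℕ // 1 ≤ i ∧ i < n}) (h : i.1 = 1) :
      YRel r n (ygen r (g i) * ygen r X * ygen r (g i) * ygen r X)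
        (ygen r X * ygen r (g i) * ygen r X * ygen r (g i))
  | g_X (i : {i : ℕ // 1 ≤ i ∧ i < n}) (h : 2 ≤ i.1) :
      YRel r n (ygen r (g i) * ygen r X) (ygen r X * ygen r (g i))
  | t_X (j : ZMod n) : YRel r n (ygen r (t j) * ygen r X) (ygen r X * ygen r (t j))

/-- The affine Yokonuma–Hecke algebra `Ŷ` over `R`. -/
abbrev Yaff (r n : ℕ) : Type := RingQuot (YRel r n)

instance (r n : ℕ) : Ring (Yaff r n) := Algebra.semiringToRing (Coeff r)

/-- The generators of `Ŷ`. -/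
def yGen (r : ℕ) {n : ℕ} (x : YGen n) : Yaff r n :=
  RingQuot.mkAlgHom (Coeff r) (YRel r n) (ygen r x)

/-- The product `g_{n-1} ⋯ g_2 g_1` in `Ŷ`. -/
def gProd (r n : ℕ) : Yaff r n :=
  ((List.finRange (n - 1)).map fun i : Fin (n - 1) =>
    yGen r (YGen.g ⟨(i : ℕ) + 1, by omega, by omega⟩)).reverse.prod

end

end AffineYokonumaHecke

namespace AffineYokonumaHecke

open Polynomial

/-! ### Arithmetic in the ring of coefficients -/

/-! Over `R` the powers ζ, …, ζ^r are distinct and Δ is invertible, so an element a with a^r = 1 is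
diagonalizable: Δ⁻¹F_c(a) is the projection on the eigenvalue ζ^c (`eval_F`, `sum_proj`). For
commuting a and b, the correction term is then (q - q⁻¹) times the projection on the joint
eigenspaces whose indices satisfy i < j, and the idempotent is the projection on i = j. An identity
between such elements can be tested on joint eigenvectors (`eq_of_forall_isEigen`), where it becomes
a comparison of indices.

For the isomorphism of Ĥ and Ĉ, trichotomy gives `corr_add_corr_swap`. If u interchanges a and b, it
also interchanges corr(a, b) and corr(b, a), so adding corr(a, b) to u trades the Yokonuma quadratic
relation for the Hecke one (`sq_twist_iff`). The braid defect does not change (`braid_twist`), and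
the permutation relations turn into the relations with ζ-weights because of `corrZeta_eq`. Adding
and subtracting corrections thus carry realizations of one presentation to realizations of the
other, and the universal properties give mutually inverse maps.

For Ŷ and Ĥ, put ρ = G X_1 with G = g_{n-1} ⋯ g_1, which is invertible. Conjugation by G already
lowers the indices of the t_j and of g_2, …, g_{n-1}, so the shift relations for ρ on these elements
say that X_1 commutes with them. The element T_{s_0} has to be ρ T_{s_1} ρ⁻¹, and the last shift
relation becomes ρ² T_{s_1} = T_{s_{n-1}} ρ², which is equivalent to the type B braid relation
(`semiconjBy_rho_sq_iff`). The other relations that involve the index 0 are ρ-conjugates of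
relations that do not. -/

lemma zetaC_isPrimitiveRoot {r : ℕ} (hr : r ≠ 0) : IsPrimitiveRoot (zetaC r) r :=
  Complex.isPrimitiveRoot_exp r hr

lemma vdm_map {k l : Type*} [CommRing k] [CommRing l] (φ : k →+* l) (r : ℕ) (z : k) :
    (vdm r z).map φ = vdm r (φ z) := by
  ext i j
  simp [vdm]

lemma vdm_zetaC_det_ne_zero {r : ℕ} (hr : r ≠ 0) : (vdm r (zetaC r)).det ≠ 0 := by
  have h : vdm r (zetaC r) =
      (Matrix.vandermonde fun j : Fin r => zetaC r ^ ((j : ℕ) + 1)).transpose := by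
    ext i j
    simp [vdm, Matrix.vandermonde_apply, pow_mul]
  rw [h, Matrix.det_transpose, Matrix.det_vandermonde_ne_zero_iff]
  intro i j hij
  have h0 : zetaC r ≠ 0 := (zetaC_isPrimitiveRoot hr).ne_zero hr
  -- The exponents run over 1, …, r, but injectivity of powers is available below r; hence one
  -- factor ζ is split off and cancelled.
  simp only [pow_succ] at hij
  exact Fin.ext ((zetaC_isPrimitiveRoot hr).pow_inj i.2 j.2 (mul_right_cancel₀ h0 hij))

/-- The element `ζ` of the base ring. -/
noncomputable def zetaBase (r : ℕ) : baseRing r := ⟨zetaC r, Algebra.subset_adjoin (by simp)⟩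

lemma zeta_eq (r : ℕ) : zeta r = LaurentPolynomial.C (zetaBase r) := rfl

lemma C_injective (r : ℕ) :
    Function.Injective (LaurentPolynomial.C : baseRing r →+* Coeff r) := fun a b h => by
  rw [← toLaurent_C, ← toLaurent_C] at h
  exact Polynomial.C_injective (toLaurent_injective h)

lemma zeta_isPrimitiveRoot {r : ℕ} (hr : r ≠ 0) : IsPrimitiveRoot (zeta r) r := by
  rw [zeta_eq]
  refine IsPrimitiveRoot.map_of_injective (f := LaurentPolynomial.C) ?_ (C_injective r)
  exact IsPrimitiveRoot.of_map_of_injective (f := (baseRing r).val)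
    (zetaC_isPrimitiveRoot hr) Subtype.val_injective

lemma deltaInv_mul_det {r : ℕ} (hr : r ≠ 0) : deltaInv r * (vdm r (zeta r)).det = 1 := by
  have h1 : (vdm r (zeta r)).det = LaurentPolynomial.C (vdm r (zetaBase r)).det := by
    rw [zeta_eq, ← vdm_map, RingHom.map_det]; rfl
  have h2 : ((vdm r (zetaBase r)).det : ℂ) = (vdm r (zetaC r)).det := by
    have := RingHom.map_det (baseRing r).val.toRingHom (vdm r (zetaBase r))
    rw [RingHom.mapMatrix_apply, vdm_map] at this
    exact this
  rw [h1, deltaInv, ← map_mul, ← map_one LaurentPolynomial.C]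
  congr 1
  apply Subtype.ext
  change ((vdm r (zetaC r)).det)⁻¹ * ((vdm r (zetaBase r)).det : ℂ) = 1
  rw [h2]
  exact inv_mul_cancel₀ (vdm_zetaC_det_ne_zero hr)

lemma rInv_mul_cast {r : ℕ} (hr : r ≠ 0) : rInv r * (r : Coeff r) = 1 := by
  rw [rInv, ← map_natCast LaurentPolynomial.C, ← map_mul, ← map_one LaurentPolynomial.C]
  congr 1
  apply Subtype.ext
  change (r : ℂ)⁻¹ * (((r : baseRing r)) : ℂ) = 1
  simp [hr]

lemma zeta_pow_succ_injective {r : ℕ} (hr : r ≠ 0) :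
    Function.Injective fun c : Fin r => zeta r ^ ((c : ℕ) + 1) := by
  intro i j hij
  have h := zeta_isPrimitiveRoot hr
  simp only [pow_succ] at hij
  exact Fin.ext (h.pow_inj i.2 j.2 ((h.isUnit hr).mul_left_injective hij))

/-- `F_c` takes the value `Δ` at `ζ^c` and vanishes at the other powers of `ζ`. -/
lemma eval_F (r : ℕ) (c d : Fin r) :
    (F r c).eval (zeta r ^ ((d : ℕ) + 1)) = if c = d then (vdm r (zeta r)).det else 0 := by
  have h := congrFun (congrFun (Matrix.adjugate_mul (vdm r (zeta r))) c) d
  rw [Matrix.mul_apply] at h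
  simpa [F, vdmPoly, eval_finsetSum, vdm, pow_mul, Matrix.one_apply] using h

/-- A polynomial vanishing at all `r`-th roots of unity is annihilated by an element of order
dividing `r`. -/
lemma aeval_eq_zero_of_eval_zeta {r : ℕ} (hr : r ≠ 0) {S : Type*} [Ring S] [Algebra (Coeff r) S]
    {a : S} (ha : a ^ r = 1) {p : (Coeff r)[X]}
    (hp : ∀ c : Fin r, p.eval (zeta r ^ ((c : ℕ) + 1)) = 0) : aeval a p = 0 := by
  have hm : (X ^ r - 1 : (Coeff r)[X]).Monic := by
    simpa using monic_X_pow_sub_C (1 : Coeff r) hr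
  have hz (c : Fin r) : (zeta r ^ ((c : ℕ) + 1)) ^ r = 1 := by
    rw [← pow_mul, mul_comm, pow_mul, (zeta_isPrimitiveRoot hr).pow_eq_one, one_pow]
  -- The remainder has degree below r and vanishes at r distinct points of the domain `R`.
  have h0 : p %ₘ (X ^ r - 1) = 0 := by
    refine eq_zero_of_natDegree_lt_card_of_eval_eq_zero _ (zeta_pow_succ_injective hr)
      (fun c => ?_) ?_
    · have := congrArg (eval (zeta r ^ ((c : ℕ) + 1))) (modByMonic_add_div p (X ^ r - 1))
      simpa [hz, hp] using this
    · have h1 : (X ^ r - 1 : (Coeff r)[X]).natDegree = r := by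
        simpa using natDegree_X_pow_sub_C (n := r) (r := (1 : Coeff r))
      rw [Fintype.card_fin]
      calc _ < (X ^ r - 1 : (Coeff r)[X]).natDegree := natDegree_modByMonic_lt _ hm (by
              intro h; rw [h] at h1; simp at h1; exact hr h1.symm)
        _ = r := h1
  rw [← modByMonic_add_div p (X ^ r - 1), h0]
  simp [ha]

/-- Polynomial calculus in an element of order dividing r only sees values at the powers of ζ. The
root count takes place in `R`, so S may have zero divisors and need not be commutative. -/
lemma aeval_eq_of_eval_zeta {r : ℕ} (hr : r ≠ 0) {S : Type*} [Ring S] [Algebra (Coeff r) S]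
    {a : S} (ha : a ^ r = 1) {p p' : (Coeff r)[X]}
    (hp : ∀ c : Fin r, p.eval (zeta r ^ ((c : ℕ) + 1)) = p'.eval (zeta r ^ ((c : ℕ) + 1))) :
    aeval a p = aeval a p' := by
  have h : aeval a (p - p') = 0 := aeval_eq_zero_of_eval_zeta hr ha fun c => by simp [hp]
  simpa [sub_eq_zero] using h

/-! ### Joint eigenvectors of elements of order dividing r -/

section Eigen

variable {r : ℕ} {S : Type*} [Ring S] [Algebra (Coeff r) S]

/-- The commutative semiring structure through which `R`-algebras are elaborated, made the preferred
source of the semiring structure on `R`. -/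
noncomputable local instance (priority := 2000) coeffSemiring (r : ℕ) : Semiring (Coeff r) :=
  CommSemiring.toSemiring

/-- `x` is an eigenvector for left multiplication by `a`, of eigenvalue `ζ^c`. -/
def IsEigen (a : S) (c : Fin r) (x : S) : Prop := a * x = zeta r ^ ((c : ℕ) + 1) • x

lemma IsEigen.aeval_mul {a x : S} {c : Fin r} (h : IsEigen a c x) (p : (Coeff r)[X]) :
    aeval a p * x = p.eval (zeta r ^ ((c : ℕ) + 1)) • x := by
  induction p using Polynomial.induction_on' with
  | add p q hp hq => simp [add_mul, hp, hq, add_smul]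
  | monomial k z =>
    have hk (k : ℕ) : a ^ k * x = (zeta r ^ ((c : ℕ) + 1)) ^ k • x := by
      induction k with
      | zero => simp
      | succ k ih => rw [pow_succ, mul_assoc, h, mul_smul_comm, ih, smul_smul, pow_succ' _ k]
    rw [aeval_monomial, mul_assoc, hk, eval_monomial, ← Algebra.smul_def, smul_smul]

lemma IsEigen.pow_mul {a x : S} {c : Fin r} (h : IsEigen a c x) (k : ℕ) :
    a ^ k * x = (zeta r ^ ((c : ℕ) + 1)) ^ k • x := by
  simpa using h.aeval_mul (X ^ k)

lemma semiconjBy_aeval {u a b : S} (h : SemiconjBy u a b) (p : (Coeff r)[X]) :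
    SemiconjBy u (aeval a p) (aeval b p) := by
  induction p using Polynomial.induction_on' with
  | add p q hp hq => simpa using hp.add_right hq
  | monomial k z =>
    rw [aeval_monomial, aeval_monomial]
    exact SemiconjBy.mul_right (Algebra.commutes z u).symm (h.pow_right k)

lemma SemiconjBy.smul_right' {u a b : S} (h : SemiconjBy u a b) (z : Coeff r) :
    SemiconjBy u (z • a) (z • b) := by
  rw [SemiconjBy, mul_smul_comm, h.eq, smul_mul_assoc]

lemma semiconjBy_finset_sum {ι : Type*} {u : S} (s : Finset ι) {a b : ι → S}
    (h : ∀ i ∈ s, SemiconjBy u (a i) (b i)) : SemiconjBy u (∑ i ∈ s, a i) (∑ i ∈ s, b i) := by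
  rw [SemiconjBy, Finset.mul_sum, Finset.sum_mul]
  exact Finset.sum_congr rfl h

/-- Correction terms are polynomial in their arguments, so an element that permutes the t_j permutes
the correction terms accordingly. All commutation rules of the braid computation come from this. -/
lemma semiconjBy_corr {u a b a' b' : S} (ha : SemiconjBy u a a') (hb : SemiconjBy u b b') :
    SemiconjBy u (corr r a b) (corr r a' b') :=
  SemiconjBy.smul_right' (semiconjBy_finset_sum _ fun _ _ => semiconjBy_finset_sum _ fun _ _ =>
    (semiconjBy_aeval ha _).mul_right (semiconjBy_aeval hb _)) _

lemma semiconjBy_idem {u a b a' b' : S} (ha : SemiconjBy u a a') (hb : SemiconjBy u b b') :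
    SemiconjBy u (idem r a b) (idem r a' b') :=
  SemiconjBy.smul_right' (semiconjBy_finset_sum _ fun _ _ =>
    (ha.pow_right _).mul_right (hb.pow_right _)) _

/-- The resolution of `1` into the spectral projections of an element of order dividing `r`. -/
lemma sum_proj (hr : r ≠ 0) {a : S} (ha : a ^ r = 1) :
    ∑ c : Fin r, deltaInv r • aeval a (F r c) = 1 := by
  have h : aeval a (∑ c : Fin r, C (deltaInv r) * F r c) = aeval a (1 : (Coeff r)[X]) := by
    refine aeval_eq_of_eval_zeta hr ha fun d => ?_
    simp [eval_finsetSum, eval_F, deltaInv_mul_det hr]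
  simpa [Algebra.smul_def] using h

lemma isEigen_aeval_F (hr : r ≠ 0) {a : S} (ha : a ^ r = 1) (c : Fin r) :
    IsEigen a c (aeval a (F r c)) := by
  have h : aeval a (X * F r c) = aeval a (C (zeta r ^ ((c : ℕ) + 1)) * F r c) := by
    refine aeval_eq_of_eval_zeta hr ha fun d => ?_
    by_cases hcd : c = d
    · subst hcd; simp
    · simp [eval_F, hcd]
  rw [map_mul, map_mul, aeval_X, aeval_C, ← Algebra.smul_def] at h
  exact h

lemma IsEigen.mul_right {a x : S} {c : Fin r} (h : IsEigen a c x) (y : S) :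
    IsEigen a c (x * y) := by
  rw [IsEigen, ← mul_assoc, h, smul_mul_assoc]

lemma IsEigen.mul_left {a x y : S} {c : Fin r} (h : IsEigen a c x) (hy : Commute a y) :
    IsEigen a c (y * x) := by
  rw [IsEigen, ← mul_assoc, hy.eq, mul_assoc, h, mul_smul_comm]

lemma mul_eq_zero_of_forall_proj (hr : r ≠ 0) {a : S} (ha : a ^ r = 1) {u y : S}
    (h : ∀ c : Fin r, u * (aeval a (F r c) * y) = 0) : u * y = 0 := by
  rw [← one_mul y, ← sum_proj hr ha, Finset.sum_mul, Finset.mul_sum]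
  refine Finset.sum_eq_zero fun c _ => ?_
  rw [smul_mul_assoc, mul_smul_comm, h, smul_zero]

/-- An element annihilating all joint eigenvectors of three commuting elements vanishes. -/
lemma eq_zero_of_forall_isEigen (hr : r ≠ 0) {a b c : S} (ha : a ^ r = 1) (hb : b ^ r = 1)
    (hc : c ^ r = 1) (hab : Commute a b) (hac : Commute a c) (hbc : Commute b c) {u : S}
    (h : ∀ (i j k : Fin r) (x : S), IsEigen a i x → IsEigen b j x → IsEigen c k x → u * x = 0) :
    u = 0 := by
  rw [← mul_one u]
  refine mul_eq_zero_of_forall_proj hr hc fun k => mul_eq_zero_of_forall_proj hr hb fun j =>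
    mul_eq_zero_of_forall_proj hr ha fun i => ?_
  rw [mul_one]
  -- The test vector is F_i(a) F_j(b) F_k(c); b and c reach their own factor by commuting past the
  -- earlier ones.
  refine h i j k _ ((isEigen_aeval_F hr ha i).mul_right _) ?_ ?_
  · exact ((isEigen_aeval_F hr hb j).mul_right _).mul_left (semiconjBy_aeval hab.symm _)
  · exact ((isEigen_aeval_F hr hc k).mul_left (semiconjBy_aeval hbc.symm _)).mul_left
      (semiconjBy_aeval hac.symm _)

/-- Three elements are enough for the braid relation, which involves t_i, t_{i+1}, t_{i+2};
identities in fewer elements are obtained by repeating one of them. -/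
lemma eq_of_forall_isEigen (hr : r ≠ 0) {a b c : S} (ha : a ^ r = 1) (hb : b ^ r = 1)
    (hc : c ^ r = 1) (hab : Commute a b) (hac : Commute a c) (hbc : Commute b c) {u v : S}
    (h : ∀ (i j k : Fin r) (x : S),
      IsEigen a i x → IsEigen b j x → IsEigen c k x → u * x = v * x) :
    u = v :=
  sub_eq_zero.1 (eq_zero_of_forall_isEigen hr ha hb hc hab hac hbc fun i j k x hi hj hk => by
    rw [sub_mul, h i j k x hi hj hk, sub_self])

lemma IsEigen.aeval_F_mul {a x : S} {i c : Fin r} (hi : IsEigen a i x) :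
    aeval a (F r c) * x = if c = i then (vdm r (zeta r)).det • x else 0 := by
  rw [hi.aeval_mul, eval_F, ite_smul, zero_smul]

lemma IsEigen.aeval_F_mul_aeval_F_mul {a b x : S} {i j c d : Fin r} (hi : IsEigen a i x)
    (hj : IsEigen b j x) :
    aeval a (F r c) * aeval b (F r d) * x =
      if c = i ∧ d = j then (vdm r (zeta r)).det ^ 2 • x else 0 := by
  rw [mul_assoc, hj.aeval_F_mul]
  by_cases hd : d = j
  · rw [if_pos hd, mul_smul_comm, hi.aeval_F_mul]
    by_cases hc : c = i <;> simp [hc, hd, smul_smul, sq]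
  · simp [hd]

lemma sum_lt_ite {M : Type*} [AddCommMonoid M] (i j : Fin r) (f : Fin r → Fin r → M) :
    (∑ c : Fin r, ∑ d : Fin r with c < d, if c = i ∧ d = j then f c d else 0) =
      if i < j then f i j else 0 := by
  simp only [Finset.sum_filter]
  rw [Finset.sum_eq_single i, Finset.sum_eq_single j]
  · simp
  · intro d _ hd; simp [hd]
  · simp
  · intro c _ hc; simp [hc]
  · simp

/-- Only the summand (c₁, c₂) = (i, j) can survive, and it occurs in the sum exactly when i < j. Its
two factors contribute Δ², which cancels Δ⁻². -/
lemma IsEigen.corr_mul (hr : r ≠ 0) {a b x : S} {i j : Fin r} (hi : IsEigen a i x)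
    (hj : IsEigen b j x) : corr r a b * x = if i < j then qdiff r • x else 0 := by
  rw [corr, smul_mul_assoc, Finset.sum_mul]
  simp only [Finset.sum_mul, hi.aeval_F_mul_aeval_F_mul hj]
  rw [sum_lt_ite i j fun _ _ => (vdm r (zeta r)).det ^ 2 • x]
  split_ifs
  · rw [smul_smul]
    congr 1
    -- The coefficient comes from x² - 1 = (x + 1)(x - 1) with x the product of Δ⁻¹ and Δ.
    linear_combination (qdiff r * (deltaInv r * (vdm r (zeta r)).det + 1)) * deltaInv_mul_det hr
  · simp

lemma IsEigen.corrZeta_mul (hr : r ≠ 0) {a b x : S} {i j : Fin r} (hi : IsEigen a i x)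
    (hj : IsEigen b j x) : corrZeta r a b * x =
      if i < j then
        ((zeta r ^ ((j : ℕ) + 1) - zeta r ^ ((i : ℕ) + 1)) * qdiff r) • x else 0 := by
  rw [corrZeta, smul_mul_assoc, Finset.sum_mul]
  simp only [Finset.sum_mul, smul_mul_assoc, hi.aeval_F_mul_aeval_F_mul hj, smul_ite, smul_zero]
  rw [sum_lt_ite i j fun c d => ((zeta r ^ ((d : ℕ) + 1) - zeta r ^ ((c : ℕ) + 1)) * qdiff r) •
    (vdm r (zeta r)).det ^ 2 • x]
  split_ifs
  · rw [smul_smul, smul_smul]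
    congr 1
    linear_combination ((zeta r ^ ((j : ℕ) + 1) - zeta r ^ ((i : ℕ) + 1)) * qdiff r *
      (deltaInv r * (vdm r (zeta r)).det + 1)) * deltaInv_mul_det hr
  · simp

lemma rInv_mul_sum_zeta (hr : r ≠ 0) (i j : Fin r) :
    rInv r * ∑ s ∈ Finset.range r,
      (zeta r ^ ((i : ℕ) + 1)) ^ s * (zeta r ^ ((j : ℕ) + 1)) ^ (r - s) =
      if i = j then 1 else 0 := by
  have hz (c : Fin r) : (zeta r ^ ((c : ℕ) + 1)) ^ r = 1 := by
    rw [← pow_mul, mul_comm, pow_mul, (zeta_isPrimitiveRoot hr).pow_eq_one, one_pow]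
  split_ifs with hij
  · subst hij
    rw [Finset.sum_congr rfl (g := fun _ => 1), Finset.sum_const, Finset.card_range, nsmul_one,
      rInv_mul_cast hr]
    intro s hs
    rw [← pow_add, Nat.add_sub_cancel' (Finset.mem_range.1 hs).le, hz]
  · set x := zeta r ^ ((i : ℕ) + 1) with hx
    set y := zeta r ^ ((j : ℕ) + 1) with hy
    have hxy : x - y ≠ 0 := sub_ne_zero.2 fun h => hij (zeta_pow_succ_injective hr h)
    -- Up to the extra factor y this is the geometric sum whose product with x - y is x^r - y^r = 0,
    -- and x - y is not a zero divisor.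
    have h1 : ∑ s ∈ Finset.range r, x ^ s * y ^ (r - s) =
        (∑ s ∈ Finset.range r, x ^ s * y ^ (r - 1 - s)) * y := by
      rw [Finset.sum_mul]
      refine Finset.sum_congr rfl fun s hs => ?_
      have := Finset.mem_range.1 hs
      rw [mul_assoc, ← pow_succ, show r - 1 - s + 1 = r - s by omega]
    have h2 := (Commute.all x y).geom_sum₂_mul r
    rw [hz, hz, sub_self] at h2
    rw [h1, (mul_eq_zero.1 h2).resolve_right hxy, zero_mul, mul_zero]

lemma IsEigen.idem_mul (hr : r ≠ 0) {a b x : S} {i j : Fin r} (hi : IsEigen a i x)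
    (hj : IsEigen b j x) : idem r a b * x = if i = j then x else 0 := by
  rw [idem, smul_mul_assoc, Finset.sum_mul]
  simp only [mul_assoc, hj.pow_mul, mul_smul_comm, hi.pow_mul, smul_smul]
  rw [← Finset.sum_smul, smul_smul]
  simp only [mul_comm (_ ^ (r - _))]
  rw [rInv_mul_sum_zeta hr, ite_smul, one_smul, zero_smul]

/-! ### Identities between correction terms and idempotents -/

section Identities

variable (hr : r ≠ 0) {a b c : S} (ha : a ^ r = 1) (hb : b ^ r = 1) (hc : c ^ r = 1)
  (hab : Commute a b) (hac : Commute a c) (hbc : Commute b c)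

include hr ha

/-- No index is smaller than itself. Together with `idem_self` this settles n = 1, where t_i and
t_{i+1} coincide. -/
lemma corr_self : corr r a a = 0 :=
  eq_of_forall_isEigen hr ha ha ha rfl rfl rfl fun i j k x hi hj hk => by
    rw [hi.corr_mul hr hi, if_neg (lt_irrefl i), zero_mul]

lemma idem_self : idem r a a = 1 :=
  eq_of_forall_isEigen hr ha ha ha rfl rfl rfl fun i j k x hi hj hk => by
    rw [hi.idem_mul hr hi, if_pos rfl, one_mul]

include hb hab

lemma corr_sq : corr r a b * corr r a b = qdiff r • corr r a b :=
  eq_of_forall_isEigen hr ha hb hb hab hab rfl fun i j k x hi hj hk => by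
    rw [mul_assoc, smul_mul_assoc, hi.corr_mul hr hj]
    split_ifs with h
    · rw [mul_smul_comm, hi.corr_mul hr hj, if_pos h]
    · simp

/-- The three terms are (q - q⁻¹) times the projections on i < j, j < i and i = j. -/
lemma corr_add_corr_swap :
    corr r a b + corr r b a + qdiff r • idem r a b = qdiff r • (1 : S) :=
  eq_of_forall_isEigen hr ha hb hb hab hab rfl fun i j k x hi hj hk => by
    rw [add_mul, add_mul, smul_mul_assoc, smul_mul_assoc, hi.corr_mul hr hj, hj.corr_mul hr hi,
      hi.idem_mul hr hj]
    rcases lt_trichotomy i j with h | h | h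
    · simp [h, h.not_gt, h.ne]
    · simp [h]
    · simp [h, h.not_gt, h.ne']

/-- On an eigenvector b acts by ζ^j and a by ζ^i, so the weight ζ^j - ζ^i is what remains when a is
moved past the correction term and becomes b. -/
lemma corrZeta_eq : corrZeta r a b = b * corr r a b - corr r a b * a :=
  eq_of_forall_isEigen hr ha hb hb hab hab rfl fun i j k x hi hj hk => by
    rw [sub_mul, mul_assoc, mul_assoc, show a * x = _ from hi, mul_smul_comm, hi.corr_mul hr hj,
      hi.corrZeta_mul hr hj]
    split_ifs with h
    · rw [mul_smul_comm, show b * x = _ from hj, smul_smul, smul_smul, ← sub_smul]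
      congr 1
      ring
    · simp

include hc hac hbc

/-- Both sides are (q - q⁻¹)³ times the projection on i < j < k. -/
lemma corr_mul_corr_mul_corr :
    corr r a b * corr r b c * corr r a b = corr r b c * corr r a b * corr r b c :=
  eq_of_forall_isEigen hr ha hb hc hab hac hbc fun i j k x hi hj hk => by
    simp only [mul_assoc, hi.corr_mul hr hj, hj.corr_mul hr hk, mul_ite, mul_zero, mul_smul_comm]
    by_cases h1 : i < j <;> by_cases h2 : j < k <;> simp [h1, h2]

/-- Both sides are (q - q⁻¹)² times the projection on max(i, j) < k; the summands on the left sort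
it by i = j, i < j and j < i. In `braid_twist` it compares the coefficients of u. -/
lemma corr_triple_left :
    corr r a c * (qdiff r • idem r a b) + corr r a b * corr r b c + corr r a c * corr r b a =
      corr r b c * corr r a c :=
  eq_of_forall_isEigen hr ha hb hc hab hac hbc fun i j k x hi hj hk => by
    simp only [add_mul, mul_assoc, smul_mul_assoc, hi.corr_mul hr hj, hj.corr_mul hr hk,
      hi.corr_mul hr hk, hj.corr_mul hr hi, hi.idem_mul hr hj, mul_ite, mul_zero, mul_smul_comm]
    rcases lt_trichotomy i j with h | h | h
    · by_cases h' : j < k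
      · simp [h, h', h.not_gt, h.ne, h.trans h']
      · simp [h', h.not_gt, h.ne]
    · subst h
      by_cases h' : i < k <;> simp [h']
    · by_cases h' : i < k
      · simp [h, h', h.not_gt, h.ne', h.trans h']
      · simp [h, h', h.not_gt, h.ne']

/-- The mirror image, with the condition i < min(j, k), sorted by comparing j and k; it compares the
coefficients of v. -/
lemma corr_triple_right :
    corr r a c * (qdiff r • idem r b c) + corr r a b * corr r b c + corr r a c * corr r c b =
      corr r a b * corr r a c :=
  eq_of_forall_isEigen hr ha hb hc hab hac hbc fun i j k x hi hj hk => by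
    simp only [add_mul, mul_assoc, smul_mul_assoc, hi.corr_mul hr hj, hj.corr_mul hr hk,
      hi.corr_mul hr hk, hk.corr_mul hr hj, hj.idem_mul hr hk, mul_ite, mul_zero, mul_smul_comm]
    rcases lt_trichotomy j k with h | h | h
    · by_cases h' : i < j
      · simp [h, h', h.not_gt, h.ne, h'.trans h]
      · simp [h, h', h.not_gt, h.ne]
    · subst h
      by_cases h' : i < j <;> simp [h']
    · by_cases h' : i < k
      · simp [h, h', h.not_gt, h.ne', h'.trans h]
      · simp [h, h', h.not_gt, h.ne']

end Identities

/-! ### Twisting by the correction term -/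

section Twist

variable (hr : r ≠ 0) {a b c : S} (ha : a ^ r = 1) (hb : b ^ r = 1) (hc : c ^ r = 1)
  (hab : Commute a b) (hac : Commute a c) (hbc : Commute b c)

include hr ha hb hab in
/-- The quadratic relation for `u` and the one for `u + corr a b` are equivalent. -/
lemma sq_twist_iff {u : S} (hu : SemiconjBy u a b) (hu' : SemiconjBy u b a) :
    (u + corr r a b) ^ 2 = 1 + qdiff r • (u + corr r a b) ↔
      u ^ 2 = 1 + qdiff r • (idem r a b * u) := by
  have h1 := corr_sq hr ha hb hab
  have h2 := (semiconjBy_corr (r := r) hu hu').eq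
  -- The cross terms of the square are corr(a, b)u + u corr(a, b) = (corr(a, b) + corr(b, a))u,
  -- which is (q - q⁻¹)(1 - e)u for the idempotent e.
  have h3 : corr r a b * u + corr r b a * u + qdiff r • (idem r a b * u) = qdiff r • u := by
    have := congrArg (· * u) (corr_add_corr_swap hr ha hb hab)
    simpa [add_mul] using this
  have key : (u + corr r a b) ^ 2 - (1 + qdiff r • (u + corr r a b)) =
      u ^ 2 - (1 + qdiff r • (idem r a b * u)) := by
    have h4 : (u + corr r a b) ^ 2 =
        u ^ 2 + (corr r a b * u + u * corr r a b) + corr r a b * corr r a b := by noncomm_ring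
    rw [h4, h1, h2, smul_add, ← h3]
    abel
  rw [← sub_eq_zero, key, sub_eq_zero]

include hr ha hb hc hab hac hbc in
/-- The braid defects of `u, v` and of their twists coincide. -/
lemma braid_twist {u v : S} (hua : SemiconjBy u a b) (hub : SemiconjBy u b a)
    (huc : SemiconjBy u c c) (hva : SemiconjBy v a a) (hvb : SemiconjBy v b c)
    (hvc : SemiconjBy v c b) (hu : u ^ 2 = 1 + qdiff r • (idem r a b * u))
    (hv : v ^ 2 = 1 + qdiff r • (idem r b c * v)) :
    (u + corr r a b) * (v + corr r b c) * (u + corr r a b) -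
        (v + corr r b c) * (u + corr r a b) * (v + corr r b c) = u * v * u - v * u * v := by
  have u1 : u * corr r b c = corr r a c * u := semiconjBy_corr hub huc
  have u2 : u * corr r a b = corr r b a * u := semiconjBy_corr hua hub
  have u3 : u * corr r a c = corr r b c * u := semiconjBy_corr hua huc
  have v1 : v * corr r a b = corr r a c * v := semiconjBy_corr hva hvb
  have v2 : v * corr r b c = corr r c b * v := semiconjBy_corr hvb hvc
  have v3 : v * corr r a c = corr r a b * v := semiconjBy_corr hva hvc
  have i1 := corr_triple_left hr ha hb hc hab hac hbc
  have i2 := corr_triple_right hr ha hb hc hab hac hbc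
  have x5 : corr r b c * corr r a b = corr r a b * corr r b c :=
    semiconjBy_corr (Commute.symm (semiconjBy_corr hab hac))
      (Commute.symm (semiconjBy_corr (Commute.refl b) hbc))
  have i3 := corr_mul_corr_mul_corr hr ha hb hc hab hac hbc
  rw [← smul_mul_assoc, sq] at hu hv
  generalize qdiff r • idem r a b = e at *
  generalize qdiff r • idem r b c = f at *
  generalize corr r a b = A at *
  generalize corr r b c = B at *
  generalize corr r a c = D at *
  generalize corr r b a = A' at *
  generalize corr r c b = B' at *
  -- Both products are brought to a normal form with the correction terms on the left. The terms
  -- Avu, Buv and D are common to both; the coefficients of u, of v and the constant terms agree by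
  -- `i1`, `i2` and `i3`. The quadratic relations enter only through uBu = Du² and vAv = Dv².
  have e1 : (u + A) * (v + B) * (u + A) =
      u * v * u + A * v * u + B * u * v + D + (D * e + A * B + D * A') * u + A * D * v +
        A * B * A := by
    have x1 : u * B * u = D + D * e * u := by rw [u1, mul_assoc, hu]; noncomm_ring
    have x2 : u * v * A = B * u * v := by rw [mul_assoc, v1, ← mul_assoc, u3]
    have x3 : A * v * A = A * D * v := by rw [mul_assoc, v1, ← mul_assoc]
    have x4 : u * B * A = D * A' * u := by rw [u1, mul_assoc, u2, ← mul_assoc]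
    have : (u + A) * (v + B) * (u + A) = u * v * u + A * v * u + u * v * A + u * B * u +
        (A * B * u + u * B * A) + A * v * A + A * B * A := by noncomm_ring
    rw [this, x1, x2, x3, x4]
    noncomm_ring
  have e2 : (v + B) * (u + A) * (v + B) =
      v * u * v + A * v * u + B * u * v + D + B * D * u + (D * f + A * B + D * B') * v +
        B * A * B := by
    have x1 : v * A * v = D + D * f * v := by rw [v1, mul_assoc, hv]; noncomm_ring
    have x2 : v * u * B = A * v * u := by rw [mul_assoc, u1, ← mul_assoc, v3]
    have x3 : B * u * B = B * D * u := by rw [mul_assoc, u1, ← mul_assoc]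
    have x4 : v * A * B = D * B' * v := by rw [v1, mul_assoc, v2, ← mul_assoc]
    have : (v + B) * (u + A) * (v + B) = v * u * v + B * u * v + v * u * B + v * A * v +
        (B * A * v + v * A * B) + B * u * B + B * A * B := by noncomm_ring
    rw [this, x1, x2, x3, x4, x5]
    noncomm_ring
  rw [e1, e2, i1, i2, i3]
  abel

/-- Twisting does not affect the commutator of far generators. -/
lemma commute_twist_iff {d u v : S} (hac : Commute a c) (hbc : Commute b c) (had : Commute a d)
    (hbd : Commute b d) (huc : Commute u c) (hud : Commute u d) (hva : Commute v a)
    (hvb : Commute v b) :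
    (u + corr r a b) * (v + corr r c d) = (v + corr r c d) * (u + corr r a b) ↔
      u * v = v * u := by
  have h1 : u * corr r c d = corr r c d * u := semiconjBy_corr huc hud
  have h2 : v * corr r a b = corr r a b * v := semiconjBy_corr hva hvb
  have h3 : corr r a b * corr r c d = corr r c d * corr r a b :=
    semiconjBy_corr (Commute.symm (semiconjBy_corr hac.symm hbc.symm))
      (Commute.symm (semiconjBy_corr had.symm hbd.symm))
  rw [add_mul, mul_add, mul_add, add_mul, mul_add, mul_add, h1, h2, h3, ← sub_eq_zero,
    ← sub_eq_zero (a := u * v)]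
  refine Eq.congr ?_ rfl
  abel

end Twist

end Eigen

end AffineYokonumaHecke

namespace AffineYokonumaHecke

/-! ### Realizations of the presentations -/

section Map

variable {r : ℕ} {S S' : Type*} [Semiring S] [Algebra (Coeff r) S] [Semiring S']
  [Algebra (Coeff r) S']

lemma map_corr (φ : S →ₐ[Coeff r] S') (a b : S) : φ (corr r a b) = corr r (φ a) (φ b) := by
  simp [corr, map_sum, Polynomial.aeval_algHom_apply]

lemma map_corrZeta (φ : S →ₐ[Coeff r] S') (a b : S) :
    φ (corrZeta r a b) = corrZeta r (φ a) (φ b) := by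
  simp [corrZeta, map_sum, Polynomial.aeval_algHom_apply]

lemma map_idem (φ : S →ₐ[Coeff r] S') (a b : S) : φ (idem r a b) = idem r (φ a) (φ b) := by
  simp [idem, map_sum]

end Map

open Gen

variable {r n : ℕ} {S : Type*} [Ring S] [Algebra (Coeff r) S]

/-- The relations shared by the generators of `Ĥ` and the untwisted generators of `Ĉ`. -/
structure IsBaseModel (r : ℕ) {n : ℕ} {S : Type*} [Ring S] [Algebra (Coeff r) S]
    (f : Gen n → S) : Prop where
  t_pow (i : ZMod n) : f (t i) ^ r = 1
  t_comm (i j : ZMod n) : Commute (f (t i)) (f (t j))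
  s_t (i j : ZMod n) (hi : i ≠ 0) : SemiconjBy (f (s i)) (f (t j)) (f (t (Equiv.swap i (i + 1) j)))
  rho_t (j : ZMod n) : SemiconjBy (f rho) (f (t j)) (f (t (j - 1)))
  rho_s (i : ZMod n) : SemiconjBy (f rho) (f (s i)) (f (s (i - 1)))
  rho_rhoInv : f rho * f rhoInv = 1
  rhoInv_rho : f rhoInv * f rho = 1

/-- The images of the generators satisfy the defining relations of `Ĥ`. -/
structure IsHModel (r : ℕ) {n : ℕ} {S : Type*} [Ring S] [Algebra (Coeff r) S]
    (f : Gen n → S) : Prop extends IsBaseModel r f where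
  s_comm (i j : ZMod n) (h : i - j ≠ 1) (h' : i - j ≠ -1) : f (s i) * f (s j) = f (s j) * f (s i)
  s_braid (i : ZMod n) (hn : 3 ≤ n) :
    f (s i) * f (s (i + 1)) * f (s i) = f (s (i + 1)) * f (s i) * f (s (i + 1))
  s_sq (i : ZMod n) :
    f (s i) ^ 2 = 1 + qdiff r • (idem r (f (t i)) (f (t (i + 1))) * f (s i))

/-- The images of the generators satisfy the defining relations of `Ĉ`. -/
structure IsCModel (r : ℕ) {n : ℕ} {S : Type*} [Ring S] [Algebra (Coeff r) S]
    (f : Gen n → S) : Prop where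
  w_pow (i : ZMod n) : f (t i) ^ r = 1
  w_comm (i j : ZMod n) : Commute (f (t i)) (f (t j))
  rho_w (j : ZMod n) : SemiconjBy (f rho) (f (t j)) (f (t (j - 1)))
  rho_h (i : ZMod n) : SemiconjBy (f rho) (f (s i)) (f (s (i - 1)))
  h_comm (i j : ZMod n) (h : i - j ≠ 1) (h' : i - j ≠ -1) : f (s i) * f (s j) = f (s j) * f (s i)
  h_braid (i : ZMod n) (hn : 3 ≤ n) :
    f (s i) * f (s (i + 1)) * f (s i) = f (s (i + 1)) * f (s i) * f (s (i + 1))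
  h_sq (i : ZMod n) : f (s i) ^ 2 = 1 + qdiff r • f (s i)
  h_w (i : ZMod n) (hi : i ≠ 0) :
    f (s i) * f (t i) = f (t (i + 1)) * f (s i) - corrZeta r (f (t i)) (f (t (i + 1)))
  h_w_succ (i : ZMod n) (hi : i ≠ 0) :
    f (s i) * f (t (i + 1)) = f (t i) * f (s i) + corrZeta r (f (t i)) (f (t (i + 1)))
  h_w_other (i l : ZMod n) (hi : i ≠ 0) (h : l ≠ i) (h' : l ≠ i + 1) :
    f (s i) * f (t l) = f (t l) * f (s i)
  rho_rhoInv : f rho * f rhoInv = 1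
  rhoInv_rho : f rhoInv * f rho = 1

lemma isHModel_hGen (r n : ℕ) : IsHModel r (hGen r (n := n)) := by
  constructor
  · constructor
    · intro i; simpa [hGen] using RingQuot.mkAlgHom_rel (Coeff r) (HRel.t_pow (r := r) i)
    · intro i j; simpa [hGen, SemiconjBy, Commute] using
        RingQuot.mkAlgHom_rel (Coeff r) (HRel.t_comm (r := r) i j)
    · intro i j hi; simpa [hGen, SemiconjBy, Commute] using
        RingQuot.mkAlgHom_rel (Coeff r) (HRel.s_t (r := r) i j hi)
    · intro j; simpa [hGen, SemiconjBy, Commute] using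
        RingQuot.mkAlgHom_rel (Coeff r) (HRel.rho_t (r := r) j)
    · intro j; simpa [hGen, SemiconjBy, Commute] using
        RingQuot.mkAlgHom_rel (Coeff r) (HRel.rho_s (r := r) j)
    · simpa [hGen] using RingQuot.mkAlgHom_rel (Coeff r) (HRel.rho_rhoInv (r := r) (n := n))
    · simpa [hGen] using RingQuot.mkAlgHom_rel (Coeff r) (HRel.rhoInv_rho (r := r) (n := n))
  · intro i j h h'
    simpa [hGen] using RingQuot.mkAlgHom_rel (Coeff r) (HRel.s_comm (r := r) i j h h')
  · intro i h
    simpa [hGen] using RingQuot.mkAlgHom_rel (Coeff r) (HRel.s_braid (r := r) i h)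
  · intro i
    simpa [hGen, map_idem] using RingQuot.mkAlgHom_rel (Coeff r) (HRel.s_sq (r := r) i)

lemma isCModel_cGen (r n : ℕ) : IsCModel r (cGen r (n := n)) := by
  constructor
  · intro i; simpa [cGen] using RingQuot.mkAlgHom_rel (Coeff r) (CRel.w_pow (r := r) i)
  · intro i j; simpa [cGen, SemiconjBy, Commute] using
        RingQuot.mkAlgHom_rel (Coeff r) (CRel.w_comm (r := r) i j)
  · intro j; simpa [cGen, SemiconjBy, Commute] using
        RingQuot.mkAlgHom_rel (Coeff r) (CRel.rho_w (r := r) j)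
  · intro j; simpa [cGen, SemiconjBy, Commute] using
        RingQuot.mkAlgHom_rel (Coeff r) (CRel.rho_h (r := r) j)
  · intro i j h h'
    simpa [cGen] using RingQuot.mkAlgHom_rel (Coeff r) (CRel.h_comm (r := r) i j h h')
  · intro i h
    simpa [cGen] using RingQuot.mkAlgHom_rel (Coeff r) (CRel.h_braid (r := r) i h)
  · intro i
    simpa [cGen] using RingQuot.mkAlgHom_rel (Coeff r) (CRel.h_sq (r := r) i)
  · intro i hi
    simpa [cGen, map_corrZeta] using RingQuot.mkAlgHom_rel (Coeff r) (CRel.h_w (r := r) i hi)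
  · intro i hi
    simpa [cGen, map_corrZeta] using RingQuot.mkAlgHom_rel (Coeff r) (CRel.h_w_succ (r := r) i hi)
  · intro i l hi h h'
    simpa [cGen] using RingQuot.mkAlgHom_rel (Coeff r) (CRel.h_w_other (r := r) i l hi h h')
  · simpa [cGen] using RingQuot.mkAlgHom_rel (Coeff r) (CRel.rho_rhoInv (r := r) (n := n))
  · simpa [cGen] using RingQuot.mkAlgHom_rel (Coeff r) (CRel.rhoInv_rho (r := r) (n := n))

/-- The homomorphism from `Ĥ` given by a realization of its relations. -/
noncomputable def hLift {f : Gen n → S} (hf : IsHModel r f) : Haff r n →ₐ[Coeff r] S :=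
  RingQuot.liftAlgHom (Coeff r) ⟨FreeAlgebra.lift (Coeff r) f, by
    intro x y h
    cases h with
    | t_pow i => simpa using hf.t_pow i
    | t_comm i j => simpa using (hf.t_comm i j).eq
    | s_t i j hi => simpa using (hf.s_t i j hi).eq
    | rho_t j => simpa using (hf.rho_t j).eq
    | rho_s i => simpa using (hf.rho_s i).eq
    | s_comm i j h h' => simpa using hf.s_comm i j h h'
    | s_braid i hn => simpa using hf.s_braid i hn
    | s_sq i => simpa [map_idem] using hf.s_sq i
    | rho_rhoInv => simpa using hf.rho_rhoInv
    | rhoInv_rho => simpa using hf.rhoInv_rho⟩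

lemma hLift_hGen {f : Gen n → S} (hf : IsHModel r f) (x : Gen n) : hLift hf (hGen r x) = f x := by
  simp [hLift, hGen]

/-- The homomorphism from `Ĉ` given by a realization of its relations. -/
noncomputable def cLift {f : Gen n → S} (hf : IsCModel r f) : Caff r n →ₐ[Coeff r] S :=
  RingQuot.liftAlgHom (Coeff r) ⟨FreeAlgebra.lift (Coeff r) f, by
    intro x y h
    cases h with
    | w_pow i => simpa using hf.w_pow i
    | w_comm i j => simpa using (hf.w_comm i j).eq
    | rho_w j => simpa using (hf.rho_w j).eq
    | rho_h i => simpa using (hf.rho_h i).eq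
    | h_comm i j h h' => simpa using hf.h_comm i j h h'
    | h_braid i hn => simpa using hf.h_braid i hn
    | h_sq i => simpa using hf.h_sq i
    | h_w i hi => simpa [map_corrZeta] using hf.h_w i hi
    | h_w_succ i hi => simpa [map_corrZeta] using hf.h_w_succ i hi
    | h_w_other i l hi h h' => simpa using hf.h_w_other i l hi h h'
    | rho_rhoInv => simpa using hf.rho_rhoInv
    | rhoInv_rho => simpa using hf.rhoInv_rho⟩

lemma cLift_cGen {f : Gen n → S} (hf : IsCModel r f) (x : Gen n) : cLift hf (cGen r x) = f x := by
  simp [cLift, cGen]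

lemma haff_hom_ext {φ ψ : Haff r n →ₐ[Coeff r] S} (h : ∀ x, φ (hGen r x) = ψ (hGen r x)) :
    φ = ψ :=
  RingQuot.ringQuot_ext' _ _ _ (FreeAlgebra.hom_ext (funext h))

lemma caff_hom_ext {φ ψ : Caff r n →ₐ[Coeff r] S} (h : ∀ x, φ (cGen r x) = ψ (cGen r x)) :
    φ = ψ :=
  RingQuot.ringQuot_ext' _ _ _ (FreeAlgebra.hom_ext (funext h))

/-! ### The twist between the two presentations -/

/-- Add the correction terms to the generators `s_i`. -/
noncomputable def twist (r : ℕ) {n : ℕ} {S : Type*} [Ring S] [Algebra (Coeff r) S] (f : Gen n → S) :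
    Gen n → S
  | t j => f (t j)
  | s i => f (s i) + corr r (f (t i)) (f (t (i + 1)))
  | rho => f rho
  | rhoInv => f rhoInv

/-- Subtract the correction terms from the generators `s_i`. -/
noncomputable def untwist (r : ℕ) {n : ℕ} {S : Type*} [Ring S] [Algebra (Coeff r) S]
    (f : Gen n → S) : Gen n → S
  | t j => f (t j)
  | s i => f (s i) - corr r (f (t i)) (f (t (i + 1)))
  | rho => f rho
  | rhoInv => f rhoInv

lemma twist_untwist (f : Gen n → S) : twist r (untwist r f) = f := by
  funext x
  cases x <;> simp [twist, untwist]

/-! ### Transfer of relations along the twist -/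

namespace IsBaseModel

variable {f : Gen n → S} (hf : IsBaseModel r f)

include hf

/-- If a relation holds up to conjugation by `ρ`, it holds. -/
lemma of_rho_mul {x y x' y' : S} (hx : SemiconjBy (f rho) x x') (hy : SemiconjBy (f rho) y y')
    (h : x = y) : x' = y' := by
  have : x' * f rho = y' * f rho := by rw [← hx.eq, ← hy.eq, h]
  have := congrArg (· * f rhoInv) this
  simpa [mul_assoc, hf.rho_rhoInv] using this

/-- The case i = 0 is the ρ-conjugate of the case i = 1, which is among the relations as soon as 1 ≠
0 in `ZMod n`. -/
lemma s_t' (hn : n ≠ 1) (i j : ZMod n) :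
    SemiconjBy (f (s i)) (f (t j)) (f (t (Equiv.swap i (i + 1) j))) := by
  by_cases hi : i = 0
  · subst hi
    have : Fact (1 < n) ∨ n = 0 := by
      rcases Nat.lt_trichotomy n 1 with h | h | h
      · exact Or.inr (by omega)
      · exact absurd h hn
      · exact Or.inl ⟨h⟩
    have h10 : (1 : ZMod n) ≠ 0 := by
      rcases this with h | h
      · exact one_ne_zero
      · subst h; exact one_ne_zero
    have h := hf.s_t 1 (j + 1) h10
    refine hf.of_rho_mul ?_ ?_ h.eq
    · simpa using (hf.rho_s 1).mul_right (hf.rho_t (j + 1))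
    · have := (hf.rho_t (Equiv.swap 1 (1 + 1) (j + 1))).mul_right (hf.rho_s 1)
      have hs : Equiv.swap (1 : ZMod n) (1 + 1) (j + 1) - 1 = Equiv.swap 0 (0 + 1) j := by
        simp only [Equiv.swap_apply_def, add_eq_right, add_left_inj, zero_add]
        split_ifs <;> simp
      simpa [hs] using this
  · exact hf.s_t i j hi

lemma s_t_left (hn : n ≠ 1) (i : ZMod n) : SemiconjBy (f (s i)) (f (t i)) (f (t (i + 1))) := by
  simpa using hf.s_t' hn i i

lemma s_t_right (hn : n ≠ 1) (i : ZMod n) : SemiconjBy (f (s i)) (f (t (i + 1))) (f (t i)) := by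
  simpa using hf.s_t' hn i (i + 1)

lemma s_t_of_ne (hn : n ≠ 1) {i j : ZMod n} (h : j ≠ i) (h' : j ≠ i + 1) :
    Commute (f (s i)) (f (t j)) := by
  have := hf.s_t' hn i j
  rwa [Equiv.swap_apply_of_ne_of_ne h h'] at this

lemma sq_iff (hr : r ≠ 0) (i : ZMod n) :
    twist r f (s i) ^ 2 = 1 + qdiff r • twist r f (s i) ↔
      f (s i) ^ 2 = 1 + qdiff r • (idem r (f (t i)) (f (t (i + 1))) * f (s i)) := by
  -- For n = 1 nothing says that s_0 commutes with t_0, but the correction is 0 and the idempotent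
  -- is 1, so the two relations are the same.
  by_cases hn : n = 1
  · subst hn
    have h : i + 1 = i := Subsingleton.elim _ _
    simp [twist, h, corr_self hr (hf.t_pow i), idem_self hr (hf.t_pow i)]
  · exact sq_twist_iff hr (hf.t_pow i) (hf.t_pow _) (hf.t_comm _ _) (hf.s_t_left hn i)
      (hf.s_t_right hn i)

lemma comm_iff (i j : ZMod n) (h : i - j ≠ 1) (h' : i - j ≠ -1) :
    twist r f (s i) * twist r f (s j) = twist r f (s j) * twist r f (s i) ↔
      f (s i) * f (s j) = f (s j) * f (s i) := by
  by_cases hn : n = 1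
  · subst hn
    exact absurd (Subsingleton.elim _ _) h
  by_cases hij : i = j
  · simp [hij]
  have h1 : j + 1 ≠ i := fun e => h (by rw [← e]; ring)
  have h2 : i + 1 ≠ j := fun e => h' (by rw [← e]; ring)
  exact commute_twist_iff (hf.t_comm _ _) (hf.t_comm _ _) (hf.t_comm _ _) (hf.t_comm _ _)
    (hf.s_t_of_ne hn (Ne.symm hij) h2.symm) (hf.s_t_of_ne hn h1 (by simpa using Ne.symm hij))
    (hf.s_t_of_ne hn hij h1.symm) (hf.s_t_of_ne hn h2 (by simpa using hij))

lemma braid_iff (hr : r ≠ 0) (hn : 3 ≤ n) (i : ZMod n)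
    (hi : ∀ i, f (s i) ^ 2 = 1 + qdiff r • (idem r (f (t i)) (f (t (i + 1))) * f (s i))) :
    twist r f (s i) * twist r f (s (i + 1)) * twist r f (s i) =
        twist r f (s (i + 1)) * twist r f (s i) * twist r f (s (i + 1)) ↔
      f (s i) * f (s (i + 1)) * f (s i) = f (s (i + 1)) * f (s i) * f (s (i + 1)) := by
  have hn1 : n ≠ 1 := by omega
  have : Fact (1 < n) := ⟨by omega⟩
  -- Here n ≥ 3 matters: i and i + 2 are distinct, so s_i fixes t_{i+2} and s_{i+1} fixes t_i.
  have h2 : (1 + 1 : ZMod n) ≠ 0 := by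
    have : ((2 : ℕ) : ZMod n) ≠ 0 := fun h => by
      have := Nat.le_of_dvd (by norm_num) ((ZMod.natCast_eq_zero_iff 2 n).1 h)
      omega
    rwa [Nat.cast_two, ← one_add_one_eq_two] at this
  rw [← sub_eq_zero, ← sub_eq_zero (a := f (s i) * f (s (i + 1)) * f (s i))]
  refine Eq.congr ?_ rfl
  refine braid_twist hr (hf.t_pow _) (hf.t_pow _) (hf.t_pow _) (hf.t_comm _ _) (hf.t_comm _ _)
    (hf.t_comm _ _) (hf.s_t_left hn1 i) (hf.s_t_right hn1 i) (hf.s_t_of_ne hn1 ?_ ?_)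
    (hf.s_t_of_ne hn1 ?_ ?_) (hf.s_t_left hn1 _) (hf.s_t_right hn1 _) (hi _) (hi _)
  · simpa [add_assoc] using h2
  · simp
  · simp
  · rw [add_assoc]; simpa using h2

end IsBaseModel

lemma IsHModel.twist (hr : r ≠ 0) {f : Gen n → S} (hf : IsHModel r f) :
    IsCModel r (twist r f) where
  w_pow := hf.t_pow
  w_comm := hf.t_comm
  rho_w := hf.rho_t
  rho_h i := by
    refine (hf.rho_s i).add_right ?_
    have := semiconjBy_corr (r := r) (hf.rho_t i) (hf.rho_t (i + 1))
    rwa [add_sub_right_comm] at this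
  h_comm i j h h' := (hf.comm_iff i j h h').2 (hf.s_comm i j h h')
  h_braid i hn := (hf.braid_iff hr hn i hf.s_sq).2 (hf.s_braid i hn)
  h_sq i := (hf.sq_iff hr i).2 (hf.s_sq i)
  h_w i hi := by
    have h := hf.s_t i i hi
    rw [Equiv.swap_apply_left] at h
    simp only [AffineYokonumaHecke.twist,
      corrZeta_eq hr (hf.t_pow i) (hf.t_pow (i + 1)) (hf.t_comm _ _), add_mul, mul_add, h.eq]
    abel
  h_w_succ i hi := by
    have h := hf.s_t i (i + 1) hi
    rw [Equiv.swap_apply_right] at h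
    have h1 : f (t i) * corr r (f (t i)) (f (t (i + 1))) =
        corr r (f (t i)) (f (t (i + 1))) * f (t i) := semiconjBy_corr rfl (hf.t_comm _ _)
    have h2 : f (t (i + 1)) * corr r (f (t i)) (f (t (i + 1))) =
        corr r (f (t i)) (f (t (i + 1))) * f (t (i + 1)) := semiconjBy_corr (hf.t_comm _ _) rfl
    simp only [AffineYokonumaHecke.twist,
      corrZeta_eq hr (hf.t_pow i) (hf.t_pow (i + 1)) (hf.t_comm _ _), add_mul, mul_add, h.eq, h1,
      h2]
    abel
  h_w_other i l hi h h' := by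
    have hs := hf.s_t i l hi
    rw [Equiv.swap_apply_of_ne_of_ne h h'] at hs
    have h1 : f (t l) * corr r (f (t i)) (f (t (i + 1))) =
        corr r (f (t i)) (f (t (i + 1))) * f (t l) :=
      semiconjBy_corr (hf.t_comm _ _) (hf.t_comm _ _)
    simp only [AffineYokonumaHecke.twist, add_mul, mul_add, hs.eq, h1]
  rho_rhoInv := hf.rho_rhoInv
  rhoInv_rho := hf.rhoInv_rho

/-- Subtracting the correction cancels the ζ-weighted terms and leaves pure permutation relations.
These come first because the equivalences for the remaining relations presuppose them. -/
lemma IsCModel.isBaseModel_untwist (hr : r ≠ 0) {f : Gen n → S} (hf : IsCModel r f) :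
    IsBaseModel r (untwist r f) where
  t_pow := hf.w_pow
  t_comm := hf.w_comm
  s_t i j hi := by
    have hz := corrZeta_eq hr (hf.w_pow i) (hf.w_pow (i + 1)) (hf.w_comm _ _)
    change (f (s i) - corr r (f (t i)) (f (t (i + 1)))) * f (t j) =
      f (t _) * (f (s i) - corr r (f (t i)) (f (t (i + 1))))
    rw [sub_mul, mul_sub]
    by_cases h : j = i
    · subst h
      rw [Equiv.swap_apply_left, hf.h_w _ hi, hz]
      abel
    by_cases h' : j = i + 1
    · subst h'
      have h1 : f (t i) * corr r (f (t i)) (f (t (i + 1))) =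
          corr r (f (t i)) (f (t (i + 1))) * f (t i) := semiconjBy_corr rfl (hf.w_comm _ _)
      have h2 : f (t (i + 1)) * corr r (f (t i)) (f (t (i + 1))) =
          corr r (f (t i)) (f (t (i + 1))) * f (t (i + 1)) := semiconjBy_corr (hf.w_comm _ _) rfl
      rw [Equiv.swap_apply_right, hf.h_w_succ _ hi, hz, h1, h2]
      abel
    · have h1 : f (t j) * corr r (f (t i)) (f (t (i + 1))) =
          corr r (f (t i)) (f (t (i + 1))) * f (t j) :=
        semiconjBy_corr (hf.w_comm _ _) (hf.w_comm _ _)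
      rw [Equiv.swap_apply_of_ne_of_ne h h', hf.h_w_other _ _ hi h h', h1]
  rho_t := hf.rho_w
  rho_s i := by
    refine (hf.rho_h i).sub_right ?_
    have := semiconjBy_corr (r := r) (hf.rho_w i) (hf.rho_w (i + 1))
    rwa [add_sub_right_comm] at this
  rho_rhoInv := hf.rho_rhoInv
  rhoInv_rho := hf.rhoInv_rho

lemma IsCModel.untwist (hr : r ≠ 0) {f : Gen n → S} (hf : IsCModel r f) :
    IsHModel r (untwist r f) := by
  have hb := hf.isBaseModel_untwist hr
  -- The equivalences are applied to the untwisted family, whose twist is `f`. The quadratic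
  -- relations are needed first, as an input to the braid equivalence.
  have hsq (i) := (hb.sq_iff hr i).1 (by rw [twist_untwist]; exact hf.h_sq i)
  exact
    { hb with
      s_comm := fun i j h h' => (hb.comm_iff i j h h').1 (by
        rw [twist_untwist]; exact hf.h_comm i j h h')
      s_braid := fun i hn => (hb.braid_iff hr hn i hsq).1 (by
        rw [twist_untwist]; exact hf.h_braid i hn)
      s_sq := hsq }

/-- The isomorphism `Ĥ ≃ Ĉ`. -/
noncomputable def haffEquivCaff (hr : r ≠ 0) (n : ℕ) : Haff r n ≃ₐ[Coeff r] Caff r n :=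
  AlgEquiv.ofAlgHom (hLift ((isCModel_cGen r n).untwist hr)) (cLift ((isHModel_hGen r n).twist hr))
    (caff_hom_ext fun x => by
      cases x <;> simp [cLift_cGen, hLift_hGen, twist, untwist, map_corr])
    (haff_hom_ext fun x => by
      cases x <;> simp [cLift_cGen, hLift_hGen, twist, untwist, map_corr])

lemma haffEquivCaff_hGen (hr : r ≠ 0) (x : Gen n) :
    haffEquivCaff hr n (hGen r x) = untwist r (cGen r) x :=
  hLift_hGen _ x

lemma haffEquivCaff_symm_cGen (hr : r ≠ 0) (x : Gen n) :
    (haffEquivCaff hr n).symm (cGen r x) = twist r (hGen r) x :=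
  cLift_cGen _ x

end AffineYokonumaHecke

namespace AffineYokonumaHecke

/-! ### Descending products in a braid monoid -/

section DescProd

variable {M : Type*} [Monoid M]

/-- The product `a_{k-1} ⋯ a_1 a_0`. -/
def descProd (a : ℕ → M) : ℕ → M
  | 0 => 1
  | k + 1 => a k * descProd a k

lemma descProd_succ' (a : ℕ → M) (k : ℕ) :
    descProd a (k + 1) = descProd (fun i => a (i + 1)) k * a 0 := by
  induction k with
  | zero => simp [descProd]
  | succ k ih => rw [descProd, ih, descProd, mul_assoc]

lemma reverse_prod_map_range (a : ℕ → M) (k : ℕ) :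
    ((List.range k).map a).reverse.prod = descProd a k := by
  induction k with
  | zero => rfl
  | succ k ih => simp [List.range_succ, descProd, ih]

lemma map_descProd {M' F : Type*} [Monoid M'] [FunLike F M M'] [MonoidHomClass F M M'] (φ : F)
    (a : ℕ → M) (k : ℕ) : φ (descProd a k) = descProd (fun i => φ (a i)) k := by
  induction k with
  | zero => exact map_one φ
  | succ k ih => rw [descProd, map_mul, ih, descProd]

lemma descProd_congr {a b : ℕ → M} {k : ℕ} (h : ∀ i < k, a i = b i) :
    descProd a k = descProd b k := by
  induction k with
  | zero => rfl
  | succ k ih => rw [descProd, descProd, h k (by omega), ih fun i hi => h i (by omega)]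

lemma isUnit_descProd {a : ℕ → M} {k : ℕ} (h : ∀ i < k, IsUnit (a i)) :
    IsUnit (descProd a k) := by
  induction k with
  | zero => exact isUnit_one
  | succ k ih => exact (h k (by omega)).mul (ih fun i hi => h i (by omega))

lemma semiconjBy_descProd {u : M} {a b : ℕ → M} {k : ℕ} (h : ∀ i < k, SemiconjBy u (a i) (b i)) :
    SemiconjBy u (descProd a k) (descProd b k) := by
  induction k with
  | zero => exact SemiconjBy.one_right u
  | succ k ih => exact (h k (by omega)).mul_right (ih fun i hi => h i (by omega))

/-- The braid relations for `a_0, …, a_{N-1}`. -/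
structure IsBraidSeq (N : ℕ) (a : ℕ → M) : Prop where
  comm (i j : ℕ) (hij : i + 2 ≤ j) (hj : j < N) : Commute (a i) (a j)
  braid (i : ℕ) (hi : i + 1 < N) : a i * a (i + 1) * a i = a (i + 1) * a i * a (i + 1)

namespace IsBraidSeq

variable {N : ℕ} {a : ℕ → M} (ha : IsBraidSeq N a)

include ha

lemma commute_descProd {k i : ℕ} (hk : k + 1 ≤ i) (hi : i < N) : Commute (descProd a k) (a i) := by
  induction k with
  | zero => exact Commute.one_left _
  | succ k ih => exact (ha.comm k i hk hi).mul_left (ih (by omega))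

/-- The factors below a_i commute with a_{i+1}, the braid relation turns a_{i+1} a_i a_{i+1} into
a_i a_{i+1} a_i, and the factors above a_{i+1} commute with a_i. -/
lemma semiconjBy_descProd_succ {k i : ℕ} (hi : i + 1 < k) (hk : k ≤ N) :
    SemiconjBy (descProd a k) (a (i + 1)) (a i) := by
  induction k with
  | zero => omega
  | succ k ih =>
    by_cases h : i + 1 = k
    · subst h
      have h1 := ha.commute_descProd (k := i) (i := i + 1) le_rfl (by omega)
      rw [descProd, descProd, SemiconjBy, mul_assoc, mul_assoc, h1.eq, ← mul_assoc, ← mul_assoc,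
        ← ha.braid i (by omega), mul_assoc, mul_assoc]
    · exact SemiconjBy.mul_left (ha.comm i k (by omega) (by omega)).symm (ih (by omega) (by omega))

end IsBraidSeq

/-- For `ρ = a_m ⋯ a_0 x`, where `x` commutes with `a_1, …, a_m`, the relation `ρ² a_0 = a_m ρ²`
amounts to the type `B` braid relation between `a_0` and `x`. -/
lemma semiconjBy_rho_sq_iff {m : ℕ} {a : ℕ → M} (ha : IsBraidSeq (m + 1) a)
    (hu : ∀ i < m + 1, IsUnit (a i)) {x : M} (hx : ∀ i < m, Commute (a (i + 1)) x) :
    SemiconjBy (descProd a (m + 1) * x * (descProd a (m + 1) * x)) (a 0) (a m) ↔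
      a 0 * x * a 0 * x = x * a 0 * x * a 0 := by
  -- Write G = G' a_0 = a_m G''. Conjugation by G lowers indices, so G G' = G'' G, and x commutes
  -- with G'. Then ρ² a_0 and a_m ρ² share the invertible left factor G'' G' a_0, and what remains
  -- are the two sides of the type B relation.
  set G := descProd a (m + 1) with hG
  set G' := descProd (fun i => a (i + 1)) m with hG'
  set G'' := descProd a m with hG''
  have e1 : G = G' * a 0 := descProd_succ' a m
  have e2 : G = a m * G'' := rfl
  have hs (i : ℕ) (hi : i < m) : SemiconjBy G (a (i + 1)) (a i) :=
    ha.semiconjBy_descProd_succ (by omega) le_rfl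
  have e3 : G * G' = G'' * G := semiconjBy_descProd hs
  have e4 : x * G' = G' * x := semiconjBy_descProd fun i hi => (hx i hi).symm
  have hsq : G * x * (G * x) = G'' * G' * (a 0 * x * (a 0 * x)) := by
    calc G * x * (G * x) = G * (x * G') * (a 0 * x) := by
          conv_lhs => rw [e1]
          rw [e1]; simp only [mul_assoc]
      _ = (G * G') * x * (a 0 * x) := by rw [e4]; simp only [mul_assoc]
      _ = G'' * G' * (a 0 * x * (a 0 * x)) := by rw [e3, e1]; simp only [mul_assoc]
  have hl : G * x * (G * x) * a 0 = G'' * G' * a 0 * (x * a 0 * x * a 0) := by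
    rw [hsq]; simp only [mul_assoc]
  have hr : a m * (G * x * (G * x)) = G'' * G' * a 0 * (a 0 * x * a 0 * x) := by
    rw [hsq, ← mul_assoc, ← mul_assoc (a m), ← e2, e3, e1]; simp only [mul_assoc]
  have hunit : IsUnit (G'' * G' * a 0) :=
    ((isUnit_descProd fun i hi => hu i (by omega)).mul
      (isUnit_descProd fun i hi => hu (i + 1) (by omega))).mul (hu 0 (by omega))
  rw [SemiconjBy, hl, hr, hunit.mul_right_inj, eq_comm]

/-- The action of a descending product of transpositions on a sequence. -/
lemma semiconjBy_descProd_torus {N : ℕ} {a b : ℕ → M}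
    (h1 : ∀ i < N, SemiconjBy (a i) (b i) (b (i + 1)))
    (h2 : ∀ i < N, SemiconjBy (a i) (b (i + 1)) (b i))
    (h3 : ∀ i < N, ∀ j ≤ N, j ≠ i → j ≠ i + 1 → SemiconjBy (a i) (b j) (b j)) {k : ℕ}
    (hk : k ≤ N) :
    SemiconjBy (descProd a k) (b 0) (b k) ∧
      (∀ j < k, SemiconjBy (descProd a k) (b (j + 1)) (b j)) ∧
      ∀ j ≤ N, k < j → SemiconjBy (descProd a k) (b j) (b j) := by
  induction k with
  | zero =>
    exact ⟨SemiconjBy.one_left _, fun j hj => absurd hj (by omega),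
      fun j _ _ => SemiconjBy.one_left _⟩
  | succ k ih =>
    obtain ⟨i1, i2, i3⟩ := ih (by omega)
    refine ⟨(h1 k (by omega)).mul_left i1, fun j hj => ?_, fun j hj hkj => ?_⟩
    · by_cases hjk : j = k
      · subst hjk
        exact (h2 j (by omega)).mul_left (i3 (j + 1) (by omega) (by omega))
      · exact (h3 k (by omega) j (by omega) (by omega) (by omega)).mul_left (i2 j (by omega))
    · exact (h3 k (by omega) j hj (by omega) (by omega)).mul_left (i3 j hj (by omega))

end DescProd

/-! ### The finite part -/

section FinModel

variable {r n : ℕ} {S : Type*} [Ring S] [Algebra (Coeff r) S]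

/-- The relations of the finite Yokonuma–Hecke algebra, where `a i` stands for `g_{i+1}` and `b j`
for `t_j`. -/
structure IsFinModel (r n : ℕ) {S : Type*} [Ring S] [Algebra (Coeff r) S] (a : ℕ → S)
    (b : ZMod n → S) : Prop extends IsBraidSeq (n - 1) a where
  t_pow (j : ZMod n) : b j ^ r = 1
  t_comm (i j : ZMod n) : Commute (b i) (b j)
  a_t (i : ℕ) (hi : i + 1 < n) (j : ZMod n) :
    SemiconjBy (a i) (b j) (b (Equiv.swap ((i + 1 : ℕ) : ZMod n) (((i + 1 : ℕ) : ZMod n) + 1) j))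
  sq (i : ℕ) (hi : i + 1 < n) :
    a i ^ 2 = 1 + qdiff r •
      (idem r (b ((i + 1 : ℕ) : ZMod n)) (b (((i + 1 : ℕ) : ZMod n) + 1)) * a i)

lemma natCast_inj_of_lt {i j : ℕ} (hi : i < n) (hj : j < n) (h : (i : ZMod n) = j) : i = j := by
  rw [ZMod.natCast_eq_natCast_iff'] at h
  rwa [Nat.mod_eq_of_lt hi, Nat.mod_eq_of_lt hj] at h

lemma idem_symm (hr : r ≠ 0) {a b : S} (ha : a ^ r = 1) (hb : b ^ r = 1) (hab : Commute a b) :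
    idem r a b = idem r b a :=
  eq_of_forall_isEigen hr ha hb hb hab hab rfl fun i j k x hi hj hk => by
    rw [hi.idem_mul hr hj, hj.idem_mul hr hi]
    simp only [eq_comm]

namespace IsFinModel

variable {a : ℕ → S} {b : ZMod n → S} (h : IsFinModel r n a b)

include h

/-- The quadratic relation gives the inverse a_i - (q - q⁻¹)e_i. It is two-sided because a_i swaps
the arguments of e_i, which is symmetric in them. -/
lemma isUnit (hr : r ≠ 0) {i : ℕ} (hi : i + 1 < n) : IsUnit (a i) := by
  have hsq := h.sq i hi
  have h1 := h.a_t i hi ((i + 1 : ℕ) : ZMod n)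
  have h2 := h.a_t i hi (((i + 1 : ℕ) : ZMod n) + 1)
  rw [Equiv.swap_apply_left] at h1
  rw [Equiv.swap_apply_right] at h2
  have h3 := (semiconjBy_idem (r := r) h1 h2).eq
  rw [idem_symm hr (h.t_pow (((i + 1 : ℕ) : ZMod n) + 1)) (h.t_pow _) (h.t_comm _ _)] at h3
  generalize idem r (b ((i + 1 : ℕ) : ZMod n)) (b (((i + 1 : ℕ) : ZMod n) + 1)) = e at *
  have h4 : a i * a i - qdiff r • (e * a i) = 1 := by rw [← pow_two, hsq, add_sub_cancel_right]
  refine ⟨⟨a i, a i - qdiff r • e, ?_, ?_⟩, rfl⟩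
  · rw [mul_sub, mul_smul_comm, h3, h4]
  · rw [sub_mul, smul_mul_assoc, h4]

lemma isUnit_descProd (hr : r ≠ 0) : IsUnit (descProd a (n - 1)) :=
  AffineYokonumaHecke.isUnit_descProd fun _ hi => h.isUnit hr (by omega)

lemma semiconjBy_descProd_t (hn : n ≠ 0) (j : ZMod n) :
    SemiconjBy (descProd a (n - 1)) (b j) (b (j - 1)) := by
  have : NeZero n := ⟨hn⟩
  obtain ⟨t1, t2, -⟩ := semiconjBy_descProd_torus (N := n - 1) (a := a)
    (b := fun j => b ((j + 1 : ℕ) : ZMod n)) (k := n - 1)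
    (fun i hi => by
      have := h.a_t i (by omega) ((i + 1 : ℕ) : ZMod n)
      rw [Equiv.swap_apply_left] at this
      simpa using this)
    (fun i hi => by
      have := h.a_t i (by omega) (((i + 1 : ℕ) : ZMod n) + 1)
      rw [Equiv.swap_apply_right] at this
      simpa using this)
    (fun i hi j hj h1 h2 => by
      have := h.a_t i (by omega) ((j + 1 : ℕ) : ZMod n)
      rwa [Equiv.swap_apply_of_ne_of_ne] at this
      · intro e
        push_cast at e
        exact h1 (natCast_inj_of_lt (n := n) (by omega) (by omega) (add_right_cancel e))
      · intro e
        rw [Nat.cast_succ] at e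
        exact h2 (natCast_inj_of_lt (n := n) (by omega) (by omega) (add_right_cancel e)))
    le_rfl
  have hlt := ZMod.val_lt (j - 1)
  have hv : (((j - 1).val : ℕ) : ZMod n) = j - 1 := ZMod.natCast_zmod_val _
  -- Value 0 is the wrap-around, where t_1 is carried through the whole product to t_n = t_0; a
  -- positive value means that the index just drops by one.
  rcases hk : (j - 1).val with _ | k
  · have hj : j = 1 := by
      rw [hk, Nat.cast_zero] at hv
      exact (sub_eq_zero.1 hv.symm)
    subst hj
    have e : n - 1 + 1 = n := by omega
    simpa [e] using t1
  · have hj : j = ((k + 1 + 1 : ℕ) : ZMod n) := by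
      rw [hk] at hv
      rw [Nat.cast_succ, hv, sub_add_cancel]
    rw [hk] at hv
    rw [← hv, hj]
    exact t2 k (by omega)

end IsFinModel

end FinModel

/-! ### Realizations of the affine Yokonuma–Hecke algebra -/

section YModel

variable {r n : ℕ} {S : Type*} [Ring S] [Algebra (Coeff r) S]

/-- The relations of the affine Yokonuma–Hecke algebra, with the indexing of `IsFinModel`. -/
structure IsYModel (r n : ℕ) {S : Type*} [Ring S] [Algebra (Coeff r) S] (a : ℕ → S)
    (b : ZMod n → S) (x y : S) : Prop extends IsFinModel r n a b where
  x_y : x * y = 1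
  y_x : y * x = 1
  a_x_zero (hn : 2 ≤ n) : a 0 * x * a 0 * x = x * a 0 * x * a 0
  a_x (i : ℕ) (hi : i + 2 < n) : Commute (a (i + 1)) x
  t_x (j : ZMod n) : Commute (b j) x

/-- The generators `g_{i+1}` of `Ŷ` as a sequence, continued by `1`. -/
noncomputable def ySeq (r n : ℕ) (i : ℕ) : Yaff r n :=
  if h : i + 1 < n then yGen r (YGen.g ⟨i + 1, by omega, h⟩) else 1

lemma ySeq_of_lt (r : ℕ) {n i : ℕ} (h : i + 1 < n) :
    ySeq r n i = yGen r (YGen.g ⟨i + 1, by omega, h⟩) := dif_pos h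

lemma gProd_eq (r n : ℕ) : gProd r n = descProd (ySeq r n) (n - 1) := by
  rw [← reverse_prod_map_range, ← List.map_coe_finRange_eq_range, List.map_map, gProd]
  congr 2
  refine List.map_congr_left fun i _ => ?_
  exact (ySeq_of_lt r (by omega)).symm

lemma isYModel_yGen (r n : ℕ) :
    IsYModel r n (ySeq r n) (fun j => yGen r (YGen.t j)) (yGen r YGen.X) (yGen r YGen.XInv) := by
  refine ⟨⟨⟨?_, ?_⟩, ?_, ?_, ?_, ?_⟩, ?_, ?_, ?_, ?_, ?_⟩
  · intro i j hij hj
    rw [ySeq_of_lt r (show i + 1 < n by omega), ySeq_of_lt r (show j + 1 < n by omega)]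
    simpa [yGen, SemiconjBy, Commute] using RingQuot.mkAlgHom_rel (Coeff r)
      (YRel.g_comm (r := r) (n := n) ⟨i + 1, by omega, by omega⟩ ⟨j + 1, by omega, by omega⟩
        (Or.inl (by simp only; omega)))
  · intro i hi
    rw [ySeq_of_lt r (show i + 1 < n by omega), ySeq_of_lt r (show i + 1 + 1 < n by omega)]
    simpa [yGen] using RingQuot.mkAlgHom_rel (Coeff r)
      (YRel.g_braid (r := r) (n := n) ⟨i + 1, by omega, by omega⟩ ⟨i + 1 + 1, by omega, by omega⟩
        rfl)
  · intro i; simpa [yGen] using RingQuot.mkAlgHom_rel (Coeff r) (YRel.t_pow (r := r) i)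
  · intro i j
    simpa [yGen, SemiconjBy, Commute] using
      RingQuot.mkAlgHom_rel (Coeff r) (YRel.t_comm (r := r) i j)
  · intro i hi j
    rw [ySeq_of_lt r hi]
    simpa [yGen, SemiconjBy, Commute] using
      RingQuot.mkAlgHom_rel (Coeff r) (YRel.g_t (r := r) ⟨i + 1, by omega, hi⟩ j)
  · intro i hi
    rw [ySeq_of_lt r hi]
    simpa [yGen, map_idem] using
      RingQuot.mkAlgHom_rel (Coeff r) (YRel.g_sq (r := r) ⟨i + 1, by omega, hi⟩)
  · simpa [yGen] using RingQuot.mkAlgHom_rel (Coeff r) (YRel.X_XInv (r := r) (n := n))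
  · simpa [yGen] using RingQuot.mkAlgHom_rel (Coeff r) (YRel.XInv_X (r := r) (n := n))
  · intro hn
    rw [ySeq_of_lt r (show 0 + 1 < n by omega)]
    simpa [yGen] using
      RingQuot.mkAlgHom_rel (Coeff r) (YRel.g_X_one (r := r) (n := n) ⟨1, by omega, by omega⟩ rfl)
  · intro i hi
    rw [ySeq_of_lt r (show i + 1 + 1 < n by omega)]
    simpa [yGen, SemiconjBy, Commute] using RingQuot.mkAlgHom_rel (Coeff r)
      (YRel.g_X (r := r) (n := n) ⟨i + 1 + 1, by omega, by omega⟩ (by simp))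
  · intro j
    simpa [yGen, SemiconjBy, Commute] using RingQuot.mkAlgHom_rel (Coeff r) (YRel.t_X (r := r) j)

/-- The images of the generators of `Ŷ` in a realization. -/
def yImage (a : ℕ → S) (b : ZMod n → S) (x y : S) : YGen n → S
  | YGen.t j => b j
  | YGen.g i => a (i.1 - 1)
  | YGen.X => x
  | YGen.XInv => y

/-- The homomorphism from `Ŷ` given by a realization of its relations. -/
noncomputable def yLift {a : ℕ → S} {b : ZMod n → S} {x y : S} (hf : IsYModel r n a b x y) :
    Yaff r n →ₐ[Coeff r] S :=
  RingQuot.liftAlgHom (Coeff r) ⟨FreeAlgebra.lift (Coeff r) (yImage a b x y), by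
    intro u v h
    cases h with
    | g_comm i j h =>
      obtain ⟨i, hi, hi'⟩ := i
      obtain ⟨j, hj, hj'⟩ := j
      rcases h with h | h
      · simpa [yImage] using (hf.comm (i - 1) (j - 1) (by simp only at h; omega) (by omega)).eq
      · simpa [yImage] using
          (hf.comm (j - 1) (i - 1) (by simp only at h; omega) (by omega)).eq.symm
    | g_braid i j h =>
      obtain ⟨i, hi, hi'⟩ := i
      obtain ⟨j, hj, hj'⟩ := j
      obtain ⟨i, rfl⟩ : ∃ k, i = k + 1 := ⟨i - 1, by omega⟩
      obtain rfl : j = i + 1 + 1 := h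
      simpa [yImage] using hf.braid i (by omega)
    | t_comm i j => simpa [yImage] using (hf.t_comm i j).eq
    | g_t i j =>
      obtain ⟨i, hi, hi'⟩ := i
      obtain ⟨i, rfl⟩ : ∃ k, i = k + 1 := ⟨i - 1, by omega⟩
      simpa [yImage] using (hf.a_t i hi' j).eq
    | t_pow i => simpa [yImage] using hf.t_pow i
    | g_sq i =>
      obtain ⟨i, hi, hi'⟩ := i
      obtain ⟨i, rfl⟩ : ∃ k, i = k + 1 := ⟨i - 1, by omega⟩
      simpa [yImage, map_idem] using hf.sq i hi'
    | X_XInv => simpa [yImage] using hf.x_y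
    | XInv_X => simpa [yImage] using hf.y_x
    | g_X_one i h =>
      obtain ⟨i, hi, hi'⟩ := i
      obtain rfl : i = 1 := h
      simpa [yImage] using hf.a_x_zero (by omega)
    | g_X i h =>
      obtain ⟨i, hi, hi'⟩ := i
      obtain ⟨i, rfl⟩ : ∃ k, i = k + 1 + 1 := ⟨i - 2, by simp only at h; omega⟩
      simpa [yImage] using (hf.a_x i hi').eq
    | t_X j => simpa [yImage] using (hf.t_x j).eq⟩

section

variable {a : ℕ → S} {b : ZMod n → S} {x y : S} (hf : IsYModel r n a b x y)

lemma yLift_yGen (z : YGen n) : yLift hf (yGen r z) = yImage a b x y z := by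
  simp [yLift, yGen]

lemma yLift_ySeq {i : ℕ} (hi : i + 1 < n) : yLift hf (ySeq r n i) = a i := by
  rw [ySeq_of_lt r hi, yLift_yGen]
  rfl

lemma yLift_descProd : yLift hf (descProd (ySeq r n) (n - 1)) = descProd a (n - 1) := by
  rw [map_descProd]
  exact descProd_congr fun i hi => yLift_ySeq hf (by omega)

end

lemma yaff_hom_ext {φ ψ : Yaff r n →ₐ[Coeff r] S} (h : ∀ x, φ (yGen r x) = ψ (yGen r x)) :
    φ = ψ :=
  RingQuot.ringQuot_ext' _ _ _ (FreeAlgebra.hom_ext (funext h))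

end YModel

/-! ### From realizations of `Ĥ` to realizations of `Ŷ` and back -/

section Translate

open Gen

variable {r n : ℕ} {S : Type*} [Ring S] [Algebra (Coeff r) S]

/-- The sequence `T_{s_1}, T_{s_2}, …` of a realization of `Ĥ`. -/
def hSeq {S : Type*} (f : Gen n → S) (i : ℕ) : S := f (s ((i + 1 : ℕ) : ZMod n))

lemma natCast_succ_ne_zero {i : ℕ} (hi : i + 1 < n) : ((i + 1 : ℕ) : ZMod n) ≠ 0 := fun h =>
  absurd (natCast_inj_of_lt (n := n) (i := i + 1) (j := 0) hi (by omega) (by simpa using h))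
    (by omega)

lemma IsHModel.isFinModel {f : Gen n → S} (hf : IsHModel r f) :
    IsFinModel r n (hSeq f) (fun j => f (t j)) := by
  refine ⟨⟨?_, ?_⟩, hf.t_pow, hf.t_comm, ?_, fun i _ => hf.s_sq _⟩
  · intro i j hij hj
    refine hf.s_comm _ _ (fun e => ?_) fun e => ?_
    -- The congruences i - j ≡ ±1 are rewritten between numbers below n, where they are equalities
    -- and contradict i + 2 ≤ j.
    · have : ((i : ℕ) : ZMod n) = ((j + 1 : ℕ) : ZMod n) := by
        push_cast at e ⊢
        linear_combination e
      have := natCast_inj_of_lt (by omega) (by omega) this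
      omega
    · have : ((i + 1 : ℕ) : ZMod n) = ((j : ℕ) : ZMod n) := by
        push_cast at e ⊢
        linear_combination e
      have := natCast_inj_of_lt (by omega) (by omega) this
      omega
  · intro i hi
    have := hf.s_braid ((i + 1 : ℕ) : ZMod n) (by omega)
    simpa [hSeq] using this
  · intro i hi j
    exact hf.s_t _ j (natCast_succ_ne_zero hi)

lemma hSeq_sub_two (hn : 2 ≤ n) {S : Type*} (f : Gen n → S) : hSeq f (n - 2) = f (s (-1)) := by
  have h : ((n - 2 + 1 + 1 : ℕ) : ZMod n) = 0 := by rw [show n - 2 + 1 + 1 = n by omega]; simp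
  rw [Nat.cast_succ] at h
  rw [hSeq, eq_neg_of_add_eq_zero_left h]

/-- A realization of `Ĥ` gives one of `Ŷ`, with `X_1 = (g_{n-1} ⋯ g_1)⁻¹ ρ`. -/
lemma IsHModel.isYModel (hr : r ≠ 0) (hn : 2 ≤ n) {f : Gen n → S} (hf : IsHModel r f) :
    IsYModel r n (hSeq f) (fun j => f (t j))
      (Ring.inverse (descProd (hSeq f) (n - 1)) * f rho)
      (f rhoInv * descProd (hSeq f) (n - 1)) := by
  have hfin := hf.isFinModel
  have hG := hfin.isUnit_descProd hr
  set G := descProd (hSeq f) (n - 1) with hGdef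
  set x := Ring.inverse G * f rho with hx
  have hGx : G * x = f rho := by rw [hx, ← mul_assoc, Ring.mul_inverse_cancel _ hG, one_mul]
  -- Whatever G and ρ conjugate to the same element commutes with x = G⁻¹ρ.
  have hcomm {u v : S} (h1 : SemiconjBy G u v) (h2 : SemiconjBy (f rho) u v) : Commute u x := by
    apply hG.mul_left_cancel
    rw [← mul_assoc, h1.eq, mul_assoc, hGx, ← h2.eq, ← hGx, mul_assoc]
  have hax (i : ℕ) (hi : i + 2 < n) : Commute (hSeq f (i + 1)) x := by
    refine hcomm (hfin.semiconjBy_descProd_succ (by omega) le_rfl) ?_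
    have := hf.rho_s ((i + 1 + 1 : ℕ) : ZMod n)
    rwa [Nat.cast_succ (i + 1), add_sub_cancel_right, ← Nat.cast_succ] at this
  refine ⟨hfin, ?_, ?_, fun _ => ?_, hax, fun j => ?_⟩
  · rw [hx, mul_assoc, ← mul_assoc (f rho), hf.rho_rhoInv, one_mul, Ring.inverse_mul_cancel _ hG]
  · rw [mul_assoc, hGx, hf.rhoInv_rho]
  · obtain ⟨m, rfl⟩ : ∃ m, n = m + 2 := ⟨n - 2, by omega⟩
    refine (semiconjBy_rho_sq_iff (m := m) hfin.toIsBraidSeq (fun i hi => hfin.isUnit hr (by omega))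
      fun i hi => hax i (by omega)).1 ?_
    change SemiconjBy (G * x * (G * x)) _ _
    rw [hGx]
    -- Conjugating twice by ρ takes s_1 to s_0 and then to s_{-1} = s_{n-1}, which is the form of
    -- the type B relation required above.
    have h0 := hf.rho_s 0
    have h1 := hf.rho_s 1
    rw [zero_sub, ← hSeq_sub_two hn f] at h0
    rw [sub_self] at h1
    have h2 : hSeq f 0 = f (s 1) := by simp [hSeq]
    rw [h2]
    exact h0.mul_left h1
  · exact hcomm (hfin.semiconjBy_descProd_t (by omega) j) (hf.rho_t j)

/-- The images of the generators of `Ĥ` in a realization of `Ŷ`. -/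
noncomputable def hImage (a : ℕ → S) (b : ZMod n → S) (x y : S) : Gen n → S
  | t j => b j
  | s i => if i = 0 then
      descProd a (n - 1) * x * a 0 * (y * Ring.inverse (descProd a (n - 1)))
    else a (i.val - 1)
  | rho => descProd a (n - 1) * x
  | rhoInv => y * Ring.inverse (descProd a (n - 1))

lemma hImage_s_succ (a : ℕ → S) (b : ZMod n → S) (x y : S) {i : ℕ} (hi : i + 1 < n) :
    hImage a b x y (s ((i + 1 : ℕ) : ZMod n)) = a i := by
  rw [hImage, if_neg (natCast_succ_ne_zero hi), ZMod.val_natCast_of_lt hi, Nat.add_sub_cancel]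

lemma exists_natCast_succ (hn : n ≠ 0) {i : ZMod n} (hi : i ≠ 0) :
    ∃ k : ℕ, k + 1 < n ∧ i = ((k + 1 : ℕ) : ZMod n) := by
  have : NeZero n := ⟨hn⟩
  have h1 := ZMod.val_lt i
  have h2 : i.val ≠ 0 := fun h => hi ((ZMod.val_eq_zero i).1 h)
  refine ⟨i.val - 1, by omega, ?_⟩
  rw [Nat.sub_add_cancel (by omega), ZMod.natCast_zmod_val]

/-- A realization of `Ŷ` gives one of `Ĥ`, with `ρ = g_{n-1} ⋯ g_1 X_1`. -/
lemma IsYModel.isHModel (hr : r ≠ 0) (hn : 2 ≤ n) {a : ℕ → S} {b : ZMod n → S} {x y : S}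
    (h : IsYModel r n a b x y) : IsHModel r (hImage a b x y) := by
  have hn0 : n ≠ 0 := by omega
  have hG := h.isUnit_descProd hr
  have ht (j : ZMod n) := h.semiconjBy_descProd_t hn0 j
  set f := hImage a b x y with hf
  have hrho : f rho = descProd a (n - 1) * x := rfl
  have hrhoInv : f rhoInv = y * Ring.inverse (descProd a (n - 1)) := rfl
  have hs0 : f (s 0) = f rho * a 0 * f rhoInv := if_pos rfl
  have hs (i : ℕ) (hi : i + 1 < n) : f (s ((i + 1 : ℕ) : ZMod n)) = a i :=
    hImage_s_succ a b x y hi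
  have hs1 : f (s 1) = a 0 := by simpa using hs 0 (by omega)
  have r1 : f rho * f rhoInv = 1 := by
    rw [hrho, hrhoInv, mul_assoc, ← mul_assoc x, h.x_y, one_mul, Ring.mul_inverse_cancel _ hG]
  have r2 : f rhoInv * f rho = 1 := by
    rw [hrho, hrhoInv, mul_assoc, ← mul_assoc (Ring.inverse _), Ring.inverse_mul_cancel _ hG,
      one_mul, h.y_x]
  have hst (i j : ZMod n) (hi : i ≠ 0) :
      SemiconjBy (f (s i)) (f (t j)) (f (t (Equiv.swap i (i + 1) j))) := by
    obtain ⟨k, hk, rfl⟩ := exists_natCast_succ hn0 hi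
    rw [hs k hk]
    exact h.a_t k hk j
  have hrt (j : ZMod n) : SemiconjBy (f rho) (f (t j)) (f (t (j - 1))) :=
    (ht j).mul_left (h.t_x j).symm
  have hrs (i : ZMod n) : SemiconjBy (f rho) (f (s i)) (f (s (i - 1))) := by
    by_cases h0 : i = 0
    · subst h0
      rw [zero_sub]
      obtain ⟨m, rfl⟩ : ∃ m, n = m + 2 := ⟨n - 2, by omega⟩
      -- Since s_0 is ρ s_1 ρ⁻¹, the wanted ρ s_0 = s_{n-1} ρ reads ρ² s_1 = s_{n-1} ρ². This is the
      -- only use of the type B relation.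
      have := (semiconjBy_rho_sq_iff (m := m) h.toIsBraidSeq (fun i hi => h.isUnit hr (by omega))
        fun i hi => h.a_x i (by omega)).2 (h.a_x_zero hn)
      change SemiconjBy (f rho * f rho) _ _ at this
      rw [← hSeq_sub_two hn f, hSeq, hs _ (by omega), hs0]
      calc f rho * (f rho * a 0 * f rhoInv) = f rho * f rho * a 0 * f rhoInv := by
            simp only [mul_assoc]
        _ = a m * (f rho * (f rho * f rhoInv)) := by rw [this.eq]; simp only [mul_assoc]
        _ = a m * f rho := by rw [r1, mul_one]
    · obtain ⟨k, hk, rfl⟩ := exists_natCast_succ hn0 h0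
      rw [hs k hk, Nat.cast_succ, add_sub_cancel_right]
      rcases k with _ | k
      · rw [Nat.cast_zero, hs0, SemiconjBy, mul_assoc _ _ (f rho), r2, mul_one]
      · rw [hs k (by omega)]
        exact (h.semiconjBy_descProd_succ (by omega) le_rfl).mul_left (h.a_x k hk).symm
  have hb : IsBaseModel r f := ⟨h.t_pow, h.t_comm, hst, hrt, hrs, r1, r2⟩
  have hcomm (i j : ZMod n) (hi : i ≠ 0) (hj : j ≠ 0) (h1 : i - j ≠ 1) (h2 : i - j ≠ -1) :
      f (s i) * f (s j) = f (s j) * f (s i) := by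
    obtain ⟨k, hk, rfl⟩ := exists_natCast_succ hn0 hi
    obtain ⟨l, hl, rfl⟩ := exists_natCast_succ hn0 hj
    rw [hs k hk, hs l hl]
    have k1 : k ≠ l + 1 := fun e => h1 (by subst e; push_cast; ring)
    have k2 : l ≠ k + 1 := fun e => h2 (by subst e; push_cast; ring)
    rcases Nat.lt_trichotomy k l with e | e | e
    · exact (h.comm k l (by omega) (by omega)).eq
    · rw [e]
    · exact (h.comm l k (by omega) (by omega)).eq.symm
  have : Fact (1 < n) := ⟨by omega⟩
  have hsucc {i : ZMod n} : SemiconjBy (f rho) (f (s (i + 1))) (f (s i)) := by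
    simpa using hrs (i + 1)
  -- The pair (0, j) is the ρ-conjugate of (1, j + 1), which avoids the index 0 because j ≠ -1.
  have hcomm' (j : ZMod n) (h1 : j ≠ 1) (h2 : j ≠ -1) :
      f (s 0) * f (s j) = f (s j) * f (s 0) := by
    refine hb.of_rho_mul (hsucc.mul_right hsucc) (hsucc.mul_right hsucc) ?_
    by_cases hj : j = 0
    · rw [hj]
    · refine hcomm _ _ (by simp) (fun e => h2 (eq_neg_of_add_eq_zero_left e))
        (fun e => h2 ?_) fun e => h1 ?_
      · linear_combination -e
      · linear_combination -e
  have hbraid (k : ℕ) (hk : k + 2 < n) : f (s ((k + 1 : ℕ) : ZMod n)) *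
      f (s (((k + 1 : ℕ) : ZMod n) + 1)) * f (s ((k + 1 : ℕ) : ZMod n)) =
      f (s (((k + 1 : ℕ) : ZMod n) + 1)) * f (s ((k + 1 : ℕ) : ZMod n)) *
        f (s (((k + 1 : ℕ) : ZMod n) + 1)) := by
    rw [← Nat.cast_succ, hs k (by omega), hs (k + 1) (by omega)]
    exact h.braid k (by omega)
  have hbraid_pred (i : ZMod n) (hi : f (s (i + 1)) * f (s (i + 1 + 1)) * f (s (i + 1)) =
      f (s (i + 1 + 1)) * f (s (i + 1)) * f (s (i + 1 + 1))) :
      f (s i) * f (s (i + 1)) * f (s i) = f (s (i + 1)) * f (s i) * f (s (i + 1)) :=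
    hb.of_rho_mul ((hsucc.mul_right hsucc).mul_right hsucc)
      ((hsucc.mul_right hsucc).mul_right hsucc) hi
  have hsq (i : ZMod n) (hi : i ≠ 0) :
      f (s i) ^ 2 = 1 + qdiff r • (idem r (f (t i)) (f (t (i + 1))) * f (s i)) := by
    obtain ⟨k, hk, rfl⟩ := exists_natCast_succ hn0 hi
    rw [hs k hk]
    exact h.sq k hk
  refine ⟨hb, fun i j h1 h2 => ?_, fun i h3 => ?_, fun i => ?_⟩
  · by_cases hi : i = 0
    · subst hi
      exact hcomm' j (fun e => h2 (by rw [e, zero_sub])) fun e => h1 (by rw [e]; ring)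
    by_cases hj : j = 0
    · subst hj
      exact (hcomm' i (by simpa using h1) (by simpa using h2)).symm
    exact hcomm i j hi hj h1 h2
  -- Only i = 0 and i = n - 1 involve s_0: the former is conjugate to i = 1, the latter to i = 0.
  · have hz : f (s 0) * f (s (0 + 1)) * f (s 0) = f (s (0 + 1)) * f (s 0) * f (s (0 + 1)) := by
      refine hbraid_pred 0 ?_
      simpa using hbraid 0 (by omega)
    by_cases hi : i = 0
    · rw [hi]; exact hz
    obtain ⟨k, hk, rfl⟩ := exists_natCast_succ hn0 hi
    by_cases hk' : k + 2 < n
    · exact hbraid k hk'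
    · have e : ((k + 1 : ℕ) : ZMod n) + 1 = 0 := by
        rw [← Nat.cast_succ, show (k + 1).succ = n by omega, ZMod.natCast_self]
      refine hbraid_pred _ ?_
      rw [e]
      exact hz
  · by_cases hi : i = 0
    · subst hi
      have h1 := hsq (0 + 1) (by simp)
      refine hb.of_rho_mul (hsucc.pow_right 2) ?_ h1
      refine (SemiconjBy.one_right _).add_right (SemiconjBy.smul_right' ?_ _)
      refine (semiconjBy_idem ?_ ?_).mul_right hsucc
      · simpa using hrt (0 + 1)
      · simpa using hrt (0 + 1 + 1)
    · exact hsq i hi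

end Translate

/-! ### The isomorphism of Ŷ and Ĥ -/

open Gen

variable {r n : ℕ}

lemma hLift_hSeq {S : Type*} [Ring S] [Algebra (Coeff r) S] {f : Gen n → S} (hf : IsHModel r f)
    (i : ℕ) : hLift hf (hSeq (hGen r) i) = hSeq f i :=
  hLift_hGen hf _

lemma map_inverse_eq_self {M : Type*} [Monoid M] (φ : M →* M) {x y : M} (hxy : x * y = 1)
    (hyx : y * x = 1) (h : φ x = x) : φ y = y :=
  left_inv_eq_right_inv (a := x) (by
    calc φ y * x = φ y * φ x := by rw [h]
      _ = 1 := by rw [← map_mul, hyx, map_one]) hxy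

lemma yLift_comp_hLift (hr : r ≠ 0) (hn : 2 ≤ n) :
    (yLift ((isHModel_hGen r n).isYModel hr hn)).comp
      (hLift ((isYModel_yGen r n).isHModel hr hn)) = AlgHom.id (Coeff r) (Haff r n) := by
  have hH := isHModel_hGen r n
  have hG := hH.isFinModel.isUnit_descProd hr
  have hrho : (yLift (hH.isYModel hr hn)) (hLift ((isYModel_yGen r n).isHModel hr hn)
      (hGen r rho)) = hGen r rho := by
    rw [hLift_hGen, hImage, map_mul, yLift_descProd, yLift_yGen, yImage, ← mul_assoc,
      Ring.mul_inverse_cancel _ hG, one_mul]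
  have hrhoInv : (yLift (hH.isYModel hr hn)) (hLift ((isYModel_yGen r n).isHModel hr hn)
      (hGen r rhoInv)) = hGen r rhoInv :=
    map_inverse_eq_self ((yLift (hH.isYModel hr hn)).comp
      (hLift ((isYModel_yGen r n).isHModel hr hn))).toRingHom.toMonoidHom hH.rho_rhoInv
      hH.rhoInv_rho hrho
  refine haff_hom_ext fun z => ?_
  rw [AlgHom.comp_apply, AlgHom.id_apply]
  cases z with
  | t j => rw [hLift_hGen, hImage, yLift_yGen, yImage]
  | rho => exact hrho
  | rhoInv => exact hrhoInv
  | s i =>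
    have hpos (k : ℕ) (hk : k + 1 < n) : (yLift (hH.isYModel hr hn))
        (hLift ((isYModel_yGen r n).isHModel hr hn) (hGen r (s ((k + 1 : ℕ) : ZMod n)))) =
          hGen r (s ((k + 1 : ℕ) : ZMod n)) := by
      rw [hLift_hGen, hImage_s_succ _ _ _ _ hk, yLift_ySeq _ hk, hSeq]
    by_cases hi : i = 0
    · have h1 := hpos 0 (by omega)
      rw [zero_add, Nat.cast_one] at h1
      have h2 := (hH.rho_s 1).eq
      rw [sub_self] at h2
      -- T_{s_0} is expressed through generators already known to be fixed.
      have h3 : hGen r (s (0 : ZMod n)) = hGen r rho * hGen r (s 1) * hGen r rhoInv := by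
        rw [h2, mul_assoc, hH.rho_rhoInv, mul_one]
      rw [hi, h3]
      simp only [map_mul, hrho, hrhoInv, h1]
    · obtain ⟨k, hk, rfl⟩ := exists_natCast_succ (by omega) hi
      exact hpos k hk

lemma hLift_comp_yLift (hr : r ≠ 0) (hn : 2 ≤ n) :
    (hLift ((isYModel_yGen r n).isHModel hr hn)).comp
      (yLift ((isHModel_hGen r n).isYModel hr hn)) = AlgHom.id (Coeff r) (Yaff r n) := by
  have hH := isHModel_hGen r n
  have hY := isYModel_yGen r n
  have hGH := hH.isFinModel.isUnit_descProd hr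
  have hGY := hY.isUnit_descProd hr
  have hG : hLift (hY.isHModel hr hn) (descProd (hSeq (hGen r)) (n - 1)) =
      descProd (ySeq r n) (n - 1) := by
    rw [map_descProd]
    refine descProd_congr fun i hi => ?_
    rw [hLift_hSeq, hSeq, hImage_s_succ _ _ _ _ (by omega)]
  have hX : hLift (hY.isHModel hr hn) (yLift (hH.isYModel hr hn) (yGen r YGen.X)) =
      yGen r YGen.X := by
    -- X_1 is compared after multiplication by the invertible G, because G X_1 is the image of T_ρ.
    apply hGY.mul_left_cancel
    conv_lhs => rw [← hG]
    rw [yLift_yGen, yImage, ← map_mul, ← mul_assoc, Ring.mul_inverse_cancel _ hGH, one_mul,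
      hLift_hGen, hImage]
  refine yaff_hom_ext fun z => ?_
  rw [AlgHom.comp_apply, AlgHom.id_apply]
  cases z with
  | t j => rw [yLift_yGen, yImage, hLift_hGen, hImage]
  | g i =>
    obtain ⟨i, hi, hi'⟩ := i
    obtain ⟨i, rfl⟩ : ∃ k, i = k + 1 := ⟨i - 1, by omega⟩
    rw [← ySeq_of_lt r hi', yLift_ySeq _ hi', hLift_hSeq, hSeq, hImage_s_succ _ _ _ _ hi']
  | X => exact hX
  | XInv =>
    exact map_inverse_eq_self ((hLift (hY.isHModel hr hn)).comp
      (yLift (hH.isYModel hr hn))).toRingHom.toMonoidHom hY.x_y hY.y_x hX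

/-- The isomorphism `Ŷ ≃ Ĥ`. -/
noncomputable def yaffEquivHaff (hr : r ≠ 0) (hn : 2 ≤ n) : Yaff r n ≃ₐ[Coeff r] Haff r n :=
  AlgEquiv.ofAlgHom (yLift ((isHModel_hGen r n).isYModel hr hn))
    (hLift ((isYModel_yGen r n).isHModel hr hn)) (yLift_comp_hLift hr hn) (hLift_comp_yLift hr hn)

lemma yaffEquivHaff_t (hr : r ≠ 0) (hn : 2 ≤ n) (j : ZMod n) :
    yaffEquivHaff hr hn (yGen r (YGen.t j)) = hGen r (t j) :=
  yLift_yGen _ _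

lemma yaffEquivHaff_g (hr : r ≠ 0) (hn : 2 ≤ n) (i : {i : ℕ // 1 ≤ i ∧ i < n}) :
    yaffEquivHaff hr hn (yGen r (YGen.g i)) = hGen r (s (i.1 : ZMod n)) := by
  refine (yLift_yGen _ _).trans ?_
  rw [yImage, hSeq, Nat.sub_add_cancel i.2.1]

lemma yaffEquivHaff_gProd_mul_X (hr : r ≠ 0) (hn : 2 ≤ n) :
    yaffEquivHaff hr hn (gProd r n * yGen r YGen.X) = hGen r rho := by
  change yLift ((isHModel_hGen r n).isYModel hr hn) _ = _
  rw [gProd_eq, map_mul, yLift_descProd, yLift_yGen, yImage, ← mul_assoc,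
    Ring.mul_inverse_cancel _ ((isHModel_hGen r n).isFinModel.isUnit_descProd hr), one_mul]

end AffineYokonumaHecke

open AffineYokonumaHecke in
theorem theorem3p2 (r n : ℕ) (hr : 1 ≤ r) (hn : 1 ≤ n) :
    (∃ φ : Haff r n ≃ₐ[Coeff r] Caff r n,
      (∀ j : ZMod n, φ (hGen r (Gen.t j)) = cGen r (Gen.t j)) ∧
      (∀ i : ZMod n, φ (hGen r (Gen.s i)) =
        cGen r (Gen.s i) - corr r (cGen r (Gen.t i)) (cGen r (Gen.t (i + 1)))) ∧
      φ (hGen r Gen.rho) = cGen r Gen.rho ∧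
      φ (hGen r Gen.rhoInv) = cGen r Gen.rhoInv ∧
      (∀ j : ZMod n, φ.symm (cGen r (Gen.t j)) = hGen r (Gen.t j)) ∧
      (∀ i : ZMod n, φ.symm (cGen r (Gen.s i)) =
        hGen r (Gen.s i) + corr r (hGen r (Gen.t i)) (hGen r (Gen.t (i + 1)))) ∧
      φ.symm (cGen r Gen.rho) = hGen r Gen.rho ∧
      φ.symm (cGen r Gen.rhoInv) = hGen r Gen.rhoInv) ∧
    (2 ≤ n → ∃ θ : Yaff r n ≃ₐ[Coeff r] Caff r n,
      (∀ j : ZMod n, θ (yGen r (YGen.t j)) = cGen r (Gen.t j)) ∧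
      (∀ i : {i : ℕ // 1 ≤ i ∧ i < n}, θ (yGen r (YGen.g i)) =
        cGen r (Gen.s (i.1 : ZMod n)) -
          corr r (cGen r (Gen.t (i.1 : ZMod n))) (cGen r (Gen.t ((i.1 : ZMod n) + 1)))) ∧
      θ (gProd r n * yGen r YGen.X) = cGen r Gen.rho) := by
  have hr0 : r ≠ 0 := by omega
  refine ⟨⟨haffEquivCaff hr0 n, fun j => haffEquivCaff_hGen hr0 _, fun i => haffEquivCaff_hGen hr0 _,
    haffEquivCaff_hGen hr0 _, haffEquivCaff_hGen hr0 _, fun j => haffEquivCaff_symm_cGen hr0 _,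
    fun i => haffEquivCaff_symm_cGen hr0 _, haffEquivCaff_symm_cGen hr0 _,
    haffEquivCaff_symm_cGen hr0 _⟩, fun hn2 => ?_⟩
  refine ⟨(yaffEquivHaff hr0 hn2).trans (haffEquivCaff hr0 n), fun j => ?_, fun i => ?_, ?_⟩
  · rw [AlgEquiv.trans_apply, yaffEquivHaff_t]
    exact haffEquivCaff_hGen hr0 _
  · rw [AlgEquiv.trans_apply, yaffEquivHaff_g]
    exact haffEquivCaff_hGen hr0 _
  · rw [AlgEquiv.trans_apply, yaffEquivHaff_gProd_mul_X]
    exact haffEquivCaff_hGen hr0 _
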